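/- Let $\Sigma^n\subset\mathbf R^{n+1}$ be a smooth closed (compact, without boundary) embedded hypersurface with smooth unit normal $\mathbf n$, second fundamental form $A$ and mean curvature $H=\mathrm{div}_\Sigma\,\mathbf n$, and suppose that $\Sigma$ is a shrinker, i.e. $H=\frac12\langle x,\mathbf n\rangle$. For a small function $u$ on $\Sigma$ let $\Sigma_u=\{p+u(p)\,\mathbf n(p)\,|\,p\in\Sigma\}$ be its normal graph, let $\mathbf n_u$ and $H_u$ be the unit normal (with $\langle \mathbf n,\mathbf n_u\rangle>0$) and the mean curvature of $\Sigma_u$ at $p+u(p)\mathbf n(p)$, and put $$\mathcal M u=w_u\left(\tfrac12\,\eta_u-H_u\right),\qquad w_u(p)=\langle\mathbf n(p),\mathbf n_u\rangle^{-1},\qquad \eta_u(p)=\langle p+u(p)\,\mathbf n(p),\mathbf n_u\rangle ,$$ so that $\partial_t u=\mathcal M u$ is the graphical rescaled mean curvature flow equation. Let $L u=\Delta u-\frac12\langle x,\nabla u\rangle+|A|^2u+\frac12u$ be the second variation operator, where $\nabla$, $\Delta$, $\mathrm{div}_\Sigma$ and $\mathrm{Hess}$ are those of $\Sigma$. Write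 $\|u\|_{C^1}=\sup_\Sigma(|u|+|\nabla u|)$ and $\|u\|_{C^2}=\sup_\Sigma(|u|+|\nabla u|+|\mathrm{Hess}_u|)$. Then $\mathcal M u=L u+\mathcal Q(u)$, where the nonlinearity $\mathcal Q(u)=\mathcal Mu-Lu$ satisfies the following. There exist $C$ and $\epsilon>0$, depending only on $\Sigma$, a map $u\mapsto\bar h_u$ from functions to functions on $\Sigma$ and a map $v\mapsto\bar V_v$ from functions to vector fields on $\Sigma$, such that for every $1\le k\le\infty$ and all functions $u,v$ on $\Sigma$ of class $C^{k+1}$ with $\|u\|_{C^1}\le\epsilon$ and $\|v\|_{C^1}\le\epsilon$ there are functions $f,h$ and tangent vector fields $V,W$ on $\Sigma$ for which $f,h,\bar h_u,V,\bar V_v,W$ are of class $C^k$ (so they are smooth if $u$ and $v$ are smooth), $\bar V_v$ is tangent to $\Sigma$, $$\mathcal Q(u)-\mathcal Q(v)=f+\mathrm{div}_\Sigma(W)+\langle\nabla\bar h_u,V\rangle+\langle\nabla(h+H\,(u-v)),\bar V_v\rangle ,$$ and, at every point of $\Sigma$, $$\begin{aligned} |f|,\ |h|,\ |W|&\le C\,(\|u\|_{C^1}+\|v\|_{C^1})\,(|u-v|+|\nabla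 u-\nabla v|),\\ |V|&\le C\,(|u-v|+|\nabla u-\nabla v|),\\ |\bar h_u|,\ |\bar V_v|&\le C\,(\|u\|_{C^1}+\|v\|_{C^1}),\\ |\nabla\bar h_u|&\le C\,\|u\|_{C^1}\,(1+|\mathrm{Hess}_u|),\\ |\mathrm{div}_\Sigma(\bar V_v)|&\le C\,\|v\|_{C^2},\\ |\mathrm{div}_\Sigma(W)|&\le C\,(\|u\|_{C^1}+\|v\|_{C^1})\,(|u-v|+|\nabla u-\nabla v|+|\mathrm{Hess}_u-\mathrm{Hess}_v|)\\ &\quad+C\,|\mathrm{Hess}_u|\,(|u-v|+|\nabla u-\nabla v|),\\ |\nabla h|&\le C\,(1+|\mathrm{Hess}_u|)\,(|u-v|+|\nabla u-\nabla v|)+C\,(|v|+|\nabla v|)\,|\mathrm{Hess}_u-\mathrm{Hess}_v| . \end{aligned}$$ -/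

import Mathlib

open scoped ContDiff InnerProductSpace

noncomputable section

namespace RescaledMCF

/-- The ambient Euclidean space `ℝ^{n+1}`. -/
abbrev Amb (n : ℕ) : Type := EuclideanSpace ℝ (Fin (n + 1))

variable {n : ℕ}

/-! ### Closed embedded hypersurfaces

Functions and vector fields on a hypersurface `S` are represented by functions on the ambient
space of which only the values on `S` matter: every notion below depends only on these values,
since derivatives are taken within `S`. Thus `ContDiffOn ℝ k u S` says that `u` is a function of
class `C^k` on the submanifold `S`. -/

/-- `S` is a smooth closed (compact, without boundary) embedded hypersurface: it is compact, and
near each of its points it is the zero set of a smooth function with non-vanishing differential. -/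
structure IsClosedHypersurface (S : Set (Amb n)) : Prop where
  isCompact : IsCompact S
  exists_local_equation : ∀ p ∈ S, ∃ (U : Set (Amb n)) (ρ : Amb n → ℝ),
    IsOpen U ∧ p ∈ U ∧ ContDiffOn ℝ ∞ ρ U ∧ (∀ x ∈ U, x ∈ S ↔ ρ x = 0) ∧
      ∀ x ∈ U, fderiv ℝ ρ x ≠ 0

/-- `N` is a smooth unit normal field along `S`. For a hypersurface, the tangent cone of `S` at `p`
is the tangent space. -/
structure IsUnitNormal (S : Set (Amb n)) (N : Amb n → Amb n) : Prop where
  contDiffOn : ContDiffOn ℝ ∞ N S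
  norm_eq_one : ∀ p ∈ S, ‖N p‖ = 1
  inner_eq_zero : ∀ p ∈ S, ∀ v ∈ tangentConeAt ℝ S p, ⟪N p, v⟫_ℝ = 0

/-! ### Calculus on a hypersurface `S` with unit normal `N` -/

/-- The orthogonal projection `v ↦ v - ⟨N(p), v⟩ N(p)` of the ambient space onto the tangent space
`T_p S = N(p)^⊥`. -/
def tanProj (N : Amb n → Amb n) (p : Amb n) : Amb n →L[ℝ] Amb n :=
  ContinuousLinearMap.id ℝ (Amb n) - (innerSL ℝ (N p)).smulRight (N p)

/-- The differential at `p` of a map `X` on `S`, as a linear map on the tangent space `T_p S`,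
extended by zero to the normal line. The derivative within `S` is determined by the values of `X`
on `S` exactly on tangent vectors, so that this is well defined. -/
def tanDeriv {F : Type*} [NormedAddCommGroup F] [NormedSpace ℝ F]
    (S : Set (Amb n)) (N : Amb n → Amb n) (X : Amb n → F) (p : Amb n) : Amb n →L[ℝ] F :=
  (fderivWithin ℝ X S p).comp (tanProj N p)

/-- The gradient `∇u` on `S`: the tangent vector that represents the differential of `u`. -/
def tanGrad (S : Set (Amb n)) (N : Amb n → Amb n) (u : Amb n → ℝ) (p : Amb n) : Amb n :=
  (InnerProductSpace.toDual ℝ (Amb n)).symm (tanDeriv S N u p)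

/-- The divergence `div_S X = ∑ ⟨∇_{e_i} X, e_i⟩`, with `e_i` an orthonormal basis of `T_p S`. -/
def tanDiv (S : Set (Amb n)) (N : Amb n → Amb n) (X : Amb n → Amb n) (p : Amb n) : ℝ :=
  LinearMap.trace ℝ (Amb n) (tanDeriv S N X p : Amb n →ₗ[ℝ] Amb n)

/-- The Hessian of `u` on `S` as the endomorphism `v ↦ (∇_v ∇u)^T` of `T_p S`, extended by zero to
the normal line; as a bilinear form it is `⟨Hess_u v, w⟩`. -/
def tanHess (S : Set (Amb n)) (N : Amb n → Amb n) (u : Amb n → ℝ) (p : Amb n) :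
    Amb n →L[ℝ] Amb n :=
  (tanProj N p).comp (tanDeriv S N (tanGrad S N u) p)

/-- The Laplacian `Δu = div_S ∇u` on `S`. -/
def tanLaplacian (S : Set (Amb n)) (N : Amb n → Amb n) (u : Amb n → ℝ) (p : Amb n) : ℝ :=
  tanDiv S N (tanGrad S N u) p

/-- The Hilbert-Schmidt norm `(∑ |T e_i|^2)^{1/2}` of an endomorphism. -/
def hsNorm (T : Amb n →L[ℝ] Amb n) : ℝ :=
  √(∑ i, ‖T (EuclideanSpace.basisFun (Fin (n + 1)) ℝ i)‖ ^ 2)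

/-- The mean curvature `H = div_S N`. -/
def meanCurv (S : Set (Amb n)) (N : Amb n → Amb n) (p : Amb n) : ℝ :=
  tanDiv S N N p

/-- The squared norm `|A|^2 = ∑ |∇_{e_i} N|^2` of the second fundamental form. -/
def secondFundSq (S : Set (Amb n)) (N : Amb n → Amb n) (p : Amb n) : ℝ :=
  hsNorm (tanDeriv S N N p) ^ 2

/-- The shrinker equation `H = ⟨x, N⟩ / 2` on `S`. -/
def IsShrinker (S : Set (Amb n)) (N : Amb n → Amb n) : Prop :=
  ∀ p ∈ S, meanCurv S N p = ⟪p, N p⟫_ℝ / 2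

/-- `X` is a vector field of class `C^k` on `S`, tangent to `S`. -/
structure IsTangentField (k : ℕ∞) (S : Set (Amb n)) (N : Amb n → Amb n) (X : Amb n → Amb n) :
    Prop where
  contDiffOn : ContDiffOn ℝ k X S
  inner_eq_zero : ∀ p ∈ S, ⟪X p, N p⟫_ℝ = 0

/-- The norm `‖u‖_{C^1} = sup (|u| + |∇u|)` on `S`. -/
def c1Norm (S : Set (Amb n)) (N : Amb n → Amb n) (u : Amb n → ℝ) : ℝ :=
  ⨆ p : S, (|u p| + ‖tanGrad S N u p‖)

/-- The norm `‖u‖_{C^2} = sup (|u| + |∇u| + |Hess_u|)` on `S`. -/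
def c2Norm (S : Set (Amb n)) (N : Amb n → Amb n) (u : Amb n → ℝ) : ℝ :=
  ⨆ p : S, (|u p| + ‖tanGrad S N u p‖ + hsNorm (tanHess S N u p))

/-! ### Normal graphs over `S` and the rescaled mean curvature flow -/

/-- The parametrization `p ↦ p + u(p) N(p)` of the graph `S_u` over `S`. -/
def graphMap (N : Amb n → Amb n) (u : Amb n → ℝ) (p : Amb n) : Amb n :=
  p + u p • N p

/-- The unit normal `n_u` of the graph `S_u` at the point `p + u(p) N(p)`, on the side of `N(p)`:
the normalized projection of `N(p)` to the orthogonal complement of the tangent space of `S_u`,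
which is the image of the differential of the parametrization. -/
def graphNormal (S : Set (Amb n)) (N : Amb n → Amb n) (u : Amb n → ℝ) (p : Amb n) : Amb n :=
  let m := (LinearMap.range
    (tanDeriv S N (graphMap N u) p : Amb n →ₗ[ℝ] Amb n))ᗮ.starProjection (N p)
  ‖m‖⁻¹ • m

/-- The isomorphism of the ambient space that is the differential `T_p S → T S_u` of the
parametrization on tangent vectors and maps `N(p)` to `n_u`. -/
def graphFrame (S : Set (Amb n)) (N : Amb n → Amb n) (u : Amb n → ℝ) (p : Amb n) :
    Amb n →L[ℝ] Amb n :=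
  tanDeriv S N (graphMap N u) p + (innerSL ℝ (N p)).smulRight (graphNormal S N u p)

/-- The mean curvature `H_u = ∑ ⟨∇_{e_i} n_u, e_i⟩` of the graph `S_u` at `p + u(p) N(p)`, with
`e_i` an orthonormal basis of the tangent space of `S_u`. The derivative of `n_u` in the direction
`e` tangent to `S_u` is the derivative of `p ↦ n_u(p)` in the direction in `T_p S` that the
differential of the parametrization maps to `e`. -/
def graphMeanCurv (S : Set (Amb n)) (N : Amb n → Amb n) (u : Amb n → ℝ) (p : Amb n) : ℝ :=
  LinearMap.trace ℝ (Amb n)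
    ((tanDeriv S N (graphNormal S N u) p).comp
      (ContinuousLinearMap.inverse (graphFrame S N u p)) : Amb n →ₗ[ℝ] Amb n)

/-- The support function `η_u(p) = ⟨p + u(p) N(p), n_u⟩`. -/
def supportFn (S : Set (Amb n)) (N : Amb n → Amb n) (u : Amb n → ℝ) (p : Amb n) : ℝ :=
  ⟪graphMap N u p, graphNormal S N u p⟫_ℝ

/-- The speed function `w_u(p) = ⟨e_{n+1}, n_u⟩⁻¹`, where `e_{n+1}`, the gradient of the signed
distance to `S`, is equal to `N(p)` at the point `p + u(p) N(p)`. -/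
def speedFn (S : Set (Amb n)) (N : Amb n → Amb n) (u : Amb n → ℝ) (p : Amb n) : ℝ :=
  (⟪N p, graphNormal S N u p⟫_ℝ)⁻¹

/-- The operator `ℳ u = w_u (η_u / 2 - H_u)` of the graphical rescaled mean curvature flow
`∂_t u = ℳ u`. -/
def rmcfOp (S : Set (Amb n)) (N : Amb n → Amb n) (u : Amb n → ℝ) (p : Amb n) : ℝ :=
  speedFn S N u p * (supportFn S N u p / 2 - graphMeanCurv S N u p)

/-- The second variation operator `L u = Δu - ⟨x, ∇u⟩ / 2 + |A|^2 u + u / 2`. -/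
def secondVarOp (S : Set (Amb n)) (N : Amb n → Amb n) (u : Amb n → ℝ) (p : Amb n) : ℝ :=
  tanLaplacian S N u p - ⟪p, tanGrad S N u p⟫_ℝ / 2 + secondFundSq S N p * u p + u p / 2

/-- The nonlinearity `𝒬(u) = ℳ u - L u`. -/
def nonlinQ (S : Set (Amb n)) (N : Amb n → Amb n) (u : Amb n → ℝ) (p : Amb n) : ℝ :=
  rmcfOp S N u p - secondVarOp S N u p

end RescaledMCF

end

noncomputable section

open Set Topology Filter

namespace RescaledMCF

variable {n : ℕ}

/-! Let A be the shape operator, R = (1 + uA)⁻¹, Y = R∇u, Z = RY and w = √(1 + |Y|²). The vector N -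
Y is normal to the graph and has length w, so w_u = w, and the geometry of the graph becomes algebra
in A, u, ∇u and the derivative DY. The algebraic core, `trace_graph`, gives w H_u = tr(RA) - tr(R
DY) + w⁻²⟨Y, DY(Z)⟩. Both second order terms have a useful structure: differentiating R shows that
tr(R DY) is div Z up to terms in the 1-jet of u, and w⁻²⟨Y, DY(Z)⟩ = ⟨∇ log w, Z⟩. With g = -log w
this yields `nonlinQ_eq`: 𝒬(u) = (⟨x, N⟩/2 - H) + Φ(u) + div(Z - ∇u) + ⟨∇g, Z⟩, where Φ involves
only the 1-jet of u.

In 𝒬(u) - 𝒬(v) the term independent of u cancels, and the last term splits as ⟨∇g_u, Z_u - Z_v⟩ +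
⟨∇(g_u - g_v), Z_v⟩. This dictates the decomposition: hbar is g, Vbar is Z, and h, V, W are the
differences of g, Z and Z - ∇u. The term H(u - v) is added under the gradient and compensated in f;
this costs only a product of first order quantities.

For the estimates, Φ, g and Z - ∇u are smooth functions F of the geometric data (x, A, DA) and of
the jet (u, ∇u), and the whole differential of F vanishes at the zero jet, because they are built
from products of factors that vanish there. Taylor estimates, uniform over the compact S, give the
quadratic bounds on F(u) - F(v), and the chain rule gives the bounds on its derivative, which are
linear in the Hessians (`exists_second_order_bounds`, `exists_jet_bounds`). -/

/-! ### Smooth local retractions onto the hypersurface -/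

/-- A zero set with non-vanishing differential has smooth local retractions whose differential is
the identity on the kernel of the differential of the defining function. -/
theorem exists_retraction_of_local_equation {U : Set (Amb n)} {ρ : Amb n → ℝ} {S : Set (Amb n)}
    (hU : IsOpen U) (hρ : ContDiffOn ℝ ∞ ρ U) (hS : ∀ x ∈ U, x ∈ S ↔ ρ x = 0)
    {x₀ : Amb n} (hxU : x₀ ∈ U) (hx₀ : x₀ ∈ S) (hd : fderiv ℝ ρ x₀ ≠ 0) :
    ∃ (O : Set (Amb n)) (π : Amb n → Amb n), IsOpen O ∧ x₀ ∈ O ∧ O ⊆ U ∧ ContDiffOn ℝ ∞ π O ∧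
      (∀ x ∈ O, π x ∈ S) ∧ (∀ x ∈ O, x ∈ S → π x = x) ∧
      ∀ x ∈ O, x ∈ S → ∀ v, fderiv ℝ ρ x v = 0 → fderiv ℝ π x v = v := by
  set l := fderiv ℝ ρ x₀ with hl
  obtain ⟨v₀, hv₀⟩ : ∃ v, l v ≠ 0 := by
    by_contra! h
    exact hd (ContinuousLinearMap.ext h)
  set ν : Amb n := (l v₀)⁻¹ • v₀ with hν
  have hlν : l ν = 1 := by simp [hν, hv₀]
  -- The map q is the projection of x - x₀ onto ker l along ν, and Φ straightens S into ker l. Since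
  -- l ν = 1, the differential of Φ at x₀ is the identity. The retraction will be Φ⁻¹ ∘ q, and q = Φ
  -- on S.
  set q : Amb n → Amb n := fun x => (x - x₀) - l (x - x₀) • ν with hq
  set Φ : Amb n → Amb n := fun x => q x + ρ x • ν with hΦ
  have hqs : ContDiff ℝ ∞ q := by
    simp only [hq]
    exact (contDiff_id.sub contDiff_const).sub
      ((l.contDiff.comp (contDiff_id.sub contDiff_const)).smul contDiff_const)
  have hΦs : ContDiffOn ℝ ∞ Φ U := hqs.contDiffOn.add (hρ.smul contDiffOn_const)
  have hΦat : ∀ x ∈ U, ContDiffAt ℝ ∞ Φ x := fun x hx => hΦs.contDiffAt (hU.mem_nhds hx)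
  have hρat : ∀ x ∈ U, DifferentiableAt ℝ ρ x := fun x hx =>
    (hρ.contDiffAt (hU.mem_nhds hx)).differentiableAt (by simp)
  have hqd : ∀ x, HasFDerivAt q (ContinuousLinearMap.id ℝ (Amb n) - l.smulRight ν) x := by
    intro x
    have h1 : HasFDerivAt (fun x : Amb n => x - x₀) (ContinuousLinearMap.id ℝ (Amb n)) x :=
      (hasFDerivAt_id x).sub_const x₀
    have h2 : HasFDerivAt (fun x : Amb n => l (x - x₀)) l x := l.hasFDerivAt.comp x h1
    exact h1.sub (h2.smul_const ν)
  have hΦd : ∀ x ∈ U, HasFDerivAt Φ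
      (ContinuousLinearMap.id ℝ (Amb n) - l.smulRight ν + (fderiv ℝ ρ x).smulRight ν) x :=
    fun x hx => (hqd x).add ((hρat x hx).hasFDerivAt.smul_const ν)
  have hΦ0 : HasFDerivAt Φ ((ContinuousLinearEquiv.refl ℝ (Amb n) : Amb n ≃L[ℝ] Amb n) :
      Amb n →L[ℝ] Amb n) x₀ := by
    have := hΦd x₀ hxU
    rw [← hl, sub_add_cancel] at this
    exact this
  set e := (hΦat x₀ hxU).toOpenPartialHomeomorph Φ hΦ0 (by simp) with he
  have heΦ : ∀ x, e x = Φ x := fun x => rfl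
  have hx₀e : x₀ ∈ e.source := (hΦat x₀ hxU).mem_toOpenPartialHomeomorph_source hΦ0 (by simp)
  have hΦx₀ : Φ x₀ = 0 := by simp [hΦ, hq, (hS x₀ hxU).1 hx₀]
  -- The inverse function theorem is shrunk to points where the differential of Φ is invertible, so
  -- that the local inverse is smooth on its whole target.
  set G : Set (Amb n) :=
    U ∩ (fderiv ℝ Φ) ⁻¹' (range ((↑) : (Amb n ≃L[ℝ] Amb n) → Amb n →L[ℝ] Amb n))
    with hG
  have hGo : IsOpen G := by
    refine ContinuousOn.isOpen_inter_preimage ?_ hU ContinuousLinearEquiv.isOpen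
    exact hΦs.continuousOn_fderiv_of_isOpen hU (by simp)
  have hx₀G : x₀ ∈ G := ⟨hxU, by rw [mem_preimage, hΦ0.fderiv]; exact mem_range_self _⟩
  set e' := e.restrOpen G hGo with he'
  have hsrc : e'.source = e.source ∩ G := rfl
  have he'Φ : ∀ x, e' x = Φ x := fun x => rfl
  have hsymm : ∀ y ∈ e'.target, ContDiffAt ℝ ∞ e'.symm y := by
    intro y hy
    have hxs := e'.map_target hy
    obtain ⟨f₀, hf₀⟩ := hxs.2.2
    refine e'.contDiffAt_symm hy (f₀' := f₀) ?_ (hΦat _ hxs.2.1)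
    rw [hf₀]
    exact ((hΦat _ hxs.2.1).differentiableAt (by simp)).hasFDerivAt
  set O := e'.source ∩ q ⁻¹' e'.target with hO
  have hx₀' : x₀ ∈ e'.source := ⟨hx₀e, hx₀G⟩
  have hq0 : q x₀ = 0 := by simp [hq]
  have hOU : O ⊆ U := fun x hx => hx.1.2.1
  have hqΦ : ∀ x ∈ O, x ∈ S → q x = Φ x := by
    intro x hx hxS
    simp [hΦ, (hS x (hOU hx)).1 hxS]
  refine ⟨O, fun x => e'.symm (q x), e'.open_source.inter (e'.open_target.preimage hqs.continuous),
    ⟨hx₀', ?_⟩, hOU, ?_, ?_, ?_, ?_⟩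
  · rw [mem_preimage, hq0, ← hΦx₀]
    exact e'.map_source hx₀'
  · intro x hx
    exact ((hsymm _ hx.2).comp x hqs.contDiffAt).contDiffWithinAt
  · intro x hx
    have hs := e'.map_target hx.2
    have h1 : Φ (e'.symm (q x)) = q x := e'.right_inv hx.2
    rw [hS _ hs.2.1]
    -- Since l ∘ q = 0 and l ν = 1, applying l to Φ(πx) = q(x) leaves ρ(πx) = 0.
    have h2 := congrArg l h1
    have h3 : ∀ x, l (q x) = 0 := by intro x; simp [hq, hlν]
    simp only [hΦ, map_add, h3, map_smul, hlν] at h2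
    simpa using h2
  · intro x hx hxS
    show e'.symm (q x) = x
    rw [hqΦ x hx hxS]
    exact e'.left_inv hx.1
  · intro x hx hxS v hv
    have hxU := hOU hx
    -- At a point of S the differentials of Φ⁻¹ ∘ q and Φ⁻¹ ∘ Φ = id differ only through the term
    -- dρ(v) ν, which vanishes on ker dρ.
    have hd1 : HasFDerivAt e'.symm (fderiv ℝ e'.symm (q x)) (q x) :=
      ((hsymm _ hx.2).differentiableAt (by simp)).hasFDerivAt
    have hd2 := hd1.comp x (hqd x)
    have hd3 : HasFDerivAt (e'.symm ∘ Φ) _ x :=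
      HasFDerivAt.comp x (by rw [← hqΦ x hx hxS]; exact hd1) (hΦd x hxU)
    have hd4 : HasFDerivAt (e'.symm ∘ Φ) (ContinuousLinearMap.id ℝ (Amb n)) x := by
      refine (hasFDerivAt_id x).congr_of_eventuallyEq ?_
      filter_upwards [e'.open_source.mem_nhds hx.1] with y hy
      exact e'.left_inv hy
    have h5 := congrArg (fun T : Amb n →L[ℝ] Amb n => T v) (hd3.unique hd4)
    have h6 : fderiv ℝ (fun x => e'.symm (q x)) x = _ := hd2.fderiv
    rw [h6]
    simpa [hv] using h5

/-- A smooth retraction onto `S` of a neighbourhood of a point, with its behaviour along the unit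
normal field `N`. -/
structure IsLocalRetraction (S : Set (Amb n)) (N : Amb n → Amb n) (O : Set (Amb n))
    (π : Amb n → Amb n) : Prop where
  isOpen : IsOpen O
  contDiffOn : ContDiffOn ℝ ∞ π O
  mapsTo : ∀ x ∈ O, π x ∈ S
  eq_self : ∀ x ∈ O, x ∈ S → π x = x
  fderiv_tangent : ∀ x ∈ O, x ∈ S → ∀ v, ⟪N x, v⟫_ℝ = 0 → fderiv ℝ π x v = v
  inner_fderiv : ∀ x ∈ O, ∀ v, ⟪N (π x), fderiv ℝ π x v⟫_ℝ = 0

/-- Curves composed with the retraction stay in S, so the image of its differential lies in the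
tangent cone and is orthogonal to N. On S this forces ker dρ ⊆ N^⊥; both are hyperplanes, hence
equal, and the differential is the identity on N^⊥. -/
theorem exists_isLocalRetraction {S : Set (Amb n)} {N : Amb n → Amb n}
    (hS : IsClosedHypersurface S) (hN : IsUnitNormal S N) {x₀ : Amb n} (hx₀ : x₀ ∈ S) :
    ∃ O π, x₀ ∈ O ∧ IsLocalRetraction S N O π := by
  obtain ⟨U, ρ, hU, hxU, hρ, hSU, hd⟩ := hS.exists_local_equation x₀ hx₀
  obtain ⟨O, π, hO, hxO, hOU, hπ, hmaps, hself, hker⟩ :=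
    exists_retraction_of_local_equation hU hρ hSU hxU hx₀ (hd x₀ hxU)
  have hin : ∀ x ∈ O, ∀ v, ⟪N (π x), fderiv ℝ π x v⟫_ℝ = 0 := by
    intro x hx v
    refine hN.inner_eq_zero _ (hmaps x hx) _ ?_
    have h1 : HasFDerivWithinAt π (fderiv ℝ π x) O x :=
      ((hπ.contDiffAt (hO.mem_nhds hx)).differentiableAt (by simp)).hasFDerivAt.hasFDerivWithinAt
    have h2 := h1.mapsTo_tangent_cone
    have h3 : v ∈ tangentConeAt ℝ O x := by
      rw [tangentConeAt_of_mem_nhds (hO.mem_nhds hx)]; trivial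
    exact tangentConeAt_mono (by rintro _ ⟨y, hy, rfl⟩; exact hmaps y hy) (h2 h3)
  refine ⟨O, π, hxO, hO, hπ, hmaps, hself, ?_, hin⟩
  intro x hx hxS v hv
  refine hker x hx hxS v ?_
  have hk : ∀ w, fderiv ℝ ρ x w = 0 → ⟪N x, w⟫_ℝ = 0 := by
    intro w hw
    have := hin x hx w
    rwa [hker x hx hxS w hw, hself x hx hxS] at this
  set l := fderiv ℝ ρ x with hl
  have hl0 : l ≠ 0 := hd x (hOU hx)
  obtain ⟨w, hw⟩ : ∃ w, l w ≠ 0 := by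
    by_contra! h
    exact hl0 (ContinuousLinearMap.ext h)
  -- A functional that vanishes on ker l is a multiple of l, here with the multiplier read off at w.
  have key : ∀ z, ⟪N x, z⟫_ℝ = (l z / l w) * ⟪N x, w⟫_ℝ := by
    intro z
    have := hk (z - (l z / l w) • w) (by simp [hw])
    rw [inner_sub_right, inner_smul_right] at this
    linarith
  have hNN : ⟪N x, N x⟫_ℝ = 1 := by
    rw [real_inner_self_eq_norm_sq, hN.norm_eq_one x hxS]; norm_num
  have hw' : ⟪N x, w⟫_ℝ ≠ 0 := by
    intro h
    have := key (N x)
    rw [h, hNN] at this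
    norm_num at this
  have := key v
  rw [hv] at this
  rcases mul_eq_zero.1 this.symm with h | h
  · rcases div_eq_zero_iff.1 h with h | h
    · exact h
    · exact absurd h hw
  · exact absurd h hw'

/-! ### Tangential calculus and symmetry of the shape operator -/

section Calculus
variable {S : Set (Amb n)} {N : Amb n → Amb n}
  {F : Type*} [NormedAddCommGroup F] [NormedSpace ℝ F]

theorem tanProj_apply (p v : Amb n) : tanProj N p v = v - ⟪N p, v⟫_ℝ • N p := by
  simp [tanProj]

theorem IsUnitNormal.inner_self (hN : IsUnitNormal S N) {p : Amb n} (hp : p ∈ S) :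
    ⟪N p, N p⟫_ℝ = 1 := by
  rw [real_inner_self_eq_norm_sq, hN.norm_eq_one p hp]; norm_num

theorem IsUnitNormal.tanProj_normal (hN : IsUnitNormal S N) {p : Amb n} (hp : p ∈ S) :
    tanProj N p (N p) = 0 := by
  rw [tanProj_apply, hN.inner_self hp]; simp

theorem IsUnitNormal.inner_tanProj (hN : IsUnitNormal S N) {p : Amb n} (hp : p ∈ S) (v : Amb n) :
    ⟪N p, tanProj N p v⟫_ℝ = 0 := by
  rw [tanProj_apply, inner_sub_right, inner_smul_right, hN.inner_self hp]; ring

theorem tanProj_of_inner_eq_zero {p v : Amb n} (h : ⟪N p, v⟫_ℝ = 0) : tanProj N p v = v := by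
  rw [tanProj_apply, h]; simp

theorem IsUnitNormal.tanDeriv_normal (hN : IsUnitNormal S N) {p : Amb n} (hp : p ∈ S)
    (X : Amb n → F) : tanDeriv S N X p (N p) = 0 := by
  simp [tanDeriv, hN.tanProj_normal hp]

theorem inner_tanGrad (u : Amb n → ℝ) (p v : Amb n) :
    ⟪tanGrad S N u p, v⟫_ℝ = tanDeriv S N u p v := by
  simp [tanGrad]

theorem IsUnitNormal.inner_tanGrad_normal (hN : IsUnitNormal S N) {p : Amb n} (hp : p ∈ S)
    (u : Amb n → ℝ) : ⟪N p, tanGrad S N u p⟫_ℝ = 0 := by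
  rw [real_inner_comm, inner_tanGrad, hN.tanDeriv_normal hp]

/-- The tangential derivative is the derivative of the composition with a local retraction. -/
theorem IsLocalRetraction.tanDeriv_eq {O : Set (Amb n)} {π : Amb n → Amb n}
    (hπ : IsLocalRetraction S N O π) (hN : IsUnitNormal S N) {p : Amb n} (hp : p ∈ S) (hpO : p ∈ O)
    {X : Amb n → F} {X' : Amb n →L[ℝ] F} (hX : HasFDerivWithinAt X X' S p) :
    X'.comp (tanProj N p) = (fderiv ℝ (X ∘ π) p).comp (tanProj N p) := by
  have hd : HasFDerivAt π (fderiv ℝ π p) p :=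
    ((hπ.contDiffOn.contDiffAt (hπ.isOpen.mem_nhds hpO)).differentiableAt (by simp)).hasFDerivAt
  have hπp := hπ.eq_self p hpO hp
  have h1 : HasFDerivWithinAt (X ∘ π) (X'.comp (fderiv ℝ π p)) O p :=
    HasFDerivWithinAt.comp p (by rw [hπp]; exact hX) hd.hasFDerivWithinAt hπ.mapsTo
  have h2 := h1.hasFDerivAt (hπ.isOpen.mem_nhds hpO)
  rw [h2.fderiv]
  ext v
  simp [hπ.fderiv_tangent p hpO hp _ (hN.inner_tanProj hp v)]

/-- A derivative within S is not unique as a linear map of the ambient space, and `fderivWithin`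
makes a choice. On tangent vectors every choice agrees with the derivative of X ∘ π on an open set.
The calculus rules below rest on this. -/
theorem tanDeriv_of_hasFDerivWithinAt (hS : IsClosedHypersurface S) (hN : IsUnitNormal S N)
    {p : Amb n} (hp : p ∈ S)
    {X : Amb n → F} {X' : Amb n →L[ℝ] F} (hX : HasFDerivWithinAt X X' S p) :
    tanDeriv S N X p = X'.comp (tanProj N p) := by
  obtain ⟨O, π, hpO, hπ⟩ := exists_isLocalRetraction hS hN hp
  rw [hπ.tanDeriv_eq hN hp hpO hX, tanDeriv,
    hπ.tanDeriv_eq hN hp hpO hX.differentiableWithinAt.hasFDerivWithinAt]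

theorem contDiffOn_tanProj (hN : IsUnitNormal S N) : ContDiffOn ℝ ∞ (tanProj N) S := by
  have h1 : ContDiffOn ℝ ∞ (fun p => innerSL ℝ (N p)) S :=
    (innerSL ℝ : Amb n →L[ℝ] Amb n →L[ℝ] ℝ).contDiff.comp_contDiffOn hN.contDiffOn
  have h2 : ContDiffOn ℝ ∞ (fun p => (innerSL ℝ (N p)).smulRight (N p)) S :=
    (ContinuousLinearMap.smulRightL ℝ (Amb n)
      (Amb n)).isBoundedBilinearMap.contDiff.comp_contDiffOn (h1.prodMk hN.contDiffOn)
  exact contDiffOn_const.sub h2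

/-- Locally the tangential derivative is the ordinary derivative of X ∘ π on an open set, composed
with the tangential projection. The bound m ≤ ∞ is there because the retraction and N are known to
be smooth, not analytic. -/
theorem contDiffOn_tanDeriv (hS : IsClosedHypersurface S) (hN : IsUnitNormal S N)
    {m k : ℕ∞ω} (hmk : m + 1 ≤ k) (hm : m ≤ ∞) {X : Amb n → F}
    (hX : ContDiffOn ℝ k X S) : ContDiffOn ℝ m (tanDeriv S N X) S := by
  intro p hp
  obtain ⟨O, π, hpO, hπ⟩ := exists_isLocalRetraction hS hN hp
  have h0 : ContDiffOn ℝ (m + 1) (X ∘ π) O :=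
    (hX.of_le hmk).comp (hπ.contDiffOn.of_le (by
      calc m + 1 ≤ ∞ + 1 := by gcongr
        _ = ∞ := rfl)) hπ.mapsTo
  have h1 : ContDiffOn ℝ m (fderiv ℝ (X ∘ π)) O := h0.fderiv_of_isOpen hπ.isOpen le_rfl
  have h2 : ContDiffWithinAt ℝ m (fun x => (fderiv ℝ (X ∘ π) x).comp (tanProj N x)) S p :=
    (h1.contDiffAt (hπ.isOpen.mem_nhds hpO)).contDiffWithinAt.clm_comp
      (((contDiffOn_tanProj hN).of_le hm) p hp)
  have hd : DifferentiableOn ℝ X S := hX.differentiableOn (by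
    rintro rfl
    simp at hmk)
  refine h2.congr_of_eventuallyEq ?_ ?_
  · filter_upwards [self_mem_nhdsWithin, mem_nhdsWithin_of_mem_nhds (hπ.isOpen.mem_nhds hpO)]
      with x hx hxO
    exact hπ.tanDeriv_eq hN hx hxO (hd x hx).hasFDerivWithinAt
  · exact hπ.tanDeriv_eq hN hp hpO (hd p hp).hasFDerivWithinAt

theorem contDiffOn_tanGrad (hS : IsClosedHypersurface S) (hN : IsUnitNormal S N)
    {m k : ℕ∞ω} (hmk : m + 1 ≤ k) (hm : m ≤ ∞) {u : Amb n → ℝ}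
    (hu : ContDiffOn ℝ k u S) : ContDiffOn ℝ m (tanGrad S N u) S :=
  (InnerProductSpace.toDual ℝ (Amb n)).symm.toContinuousLinearEquiv.contDiff.comp_contDiffOn
    (contDiffOn_tanDeriv hS hN hmk hm hu)

/-- Chain rule for the tangential derivative. -/
theorem tanDeriv_comp {G : Type*} [NormedAddCommGroup G] [NormedSpace ℝ G]
    (hS : IsClosedHypersurface S) (hN : IsUnitNormal S N) {p : Amb n} (hp : p ∈ S)
    {X : Amb n → F} (hX : DifferentiableWithinAt ℝ X S p) {Ψ : F → G} {Ψ' : F →L[ℝ] G}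
    (hΨ : HasFDerivAt Ψ Ψ' (X p)) :
    tanDeriv S N (fun x => Ψ (X x)) p = Ψ'.comp (tanDeriv S N X p) := by
  exact (tanDeriv_of_hasFDerivWithinAt hS hN hp
    (hΨ.comp_hasFDerivWithinAt p hX.hasFDerivWithinAt)).trans
      (ContinuousLinearMap.comp_assoc _ _ _)

theorem tanDeriv_congr {p : Amb n} (hp : p ∈ S) {X X₁ : Amb n → F} (h : EqOn X X₁ S) :
    tanDeriv S N X p = tanDeriv S N X₁ p := by
  rw [tanDeriv, tanDeriv, fderivWithin_congr h (h hp)]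

theorem tanDeriv_add (hS : IsClosedHypersurface S) (hN : IsUnitNormal S N) {p : Amb n}
    (hp : p ∈ S) {X X₁ : Amb n → F} (hX : DifferentiableWithinAt ℝ X S p)
    (hX₁ : DifferentiableWithinAt ℝ X₁ S p) :
    tanDeriv S N (fun x => X x + X₁ x) p = tanDeriv S N X p + tanDeriv S N X₁ p := by
  rw [tanDeriv_of_hasFDerivWithinAt hS hN hp
    (hX.hasFDerivWithinAt.fun_add hX₁.hasFDerivWithinAt), tanDeriv, tanDeriv,
    ContinuousLinearMap.add_comp]

theorem tanDeriv_sub (hS : IsClosedHypersurface S) (hN : IsUnitNormal S N) {p : Amb n}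
    (hp : p ∈ S) {X X₁ : Amb n → F} (hX : DifferentiableWithinAt ℝ X S p)
    (hX₁ : DifferentiableWithinAt ℝ X₁ S p) :
    tanDeriv S N (fun x => X x - X₁ x) p = tanDeriv S N X p - tanDeriv S N X₁ p := by
  rw [tanDeriv_of_hasFDerivWithinAt hS hN hp
    (hX.hasFDerivWithinAt.fun_sub hX₁.hasFDerivWithinAt), tanDeriv, tanDeriv,
    ContinuousLinearMap.sub_comp]

theorem tanDeriv_prodMk {G : Type*} [NormedAddCommGroup G] [NormedSpace ℝ G]
    (hS : IsClosedHypersurface S) (hN : IsUnitNormal S N) {p : Amb n}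
    (hp : p ∈ S) {X : Amb n → F} {X₁ : Amb n → G} (hX : DifferentiableWithinAt ℝ X S p)
    (hX₁ : DifferentiableWithinAt ℝ X₁ S p) :
    tanDeriv S N (fun x => (X x, X₁ x)) p = (tanDeriv S N X p).prod (tanDeriv S N X₁ p) := by
  rw [tanDeriv_of_hasFDerivWithinAt hS hN hp
    (hX.hasFDerivWithinAt.prodMk hX₁.hasFDerivWithinAt)]
  rfl

/-- Product rule for the tangential derivative. -/
theorem tanDeriv_bilin_apply {G K : Type*} [NormedAddCommGroup G] [NormedSpace ℝ G]
    [NormedAddCommGroup K] [NormedSpace ℝ K]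
    (hS : IsClosedHypersurface S) (hN : IsUnitNormal S N) (B : F →L[ℝ] G →L[ℝ] K) {p : Amb n}
    (hp : p ∈ S) {X : Amb n → F} {X₁ : Amb n → G} (hX : DifferentiableWithinAt ℝ X S p)
    (hX₁ : DifferentiableWithinAt ℝ X₁ S p) (e : Amb n) :
    tanDeriv S N (fun x => B (X x) (X₁ x)) p e =
      B (tanDeriv S N X p e) (X₁ p) + B (X p) (tanDeriv S N X₁ p e) := by
  rw [tanDeriv_of_hasFDerivWithinAt hS hN hp
    (B.hasFDerivWithinAt_of_bilinear hX.hasFDerivWithinAt hX₁.hasFDerivWithinAt)]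
  simp [tanDeriv, add_comm]

theorem tanDeriv_inner_apply (hS : IsClosedHypersurface S) (hN : IsUnitNormal S N) {p : Amb n}
    (hp : p ∈ S) {X X₁ : Amb n → Amb n} (hX : DifferentiableWithinAt ℝ X S p)
    (hX₁ : DifferentiableWithinAt ℝ X₁ S p) (e : Amb n) :
    tanDeriv S N (fun x => ⟪X x, X₁ x⟫_ℝ) p e =
      ⟪tanDeriv S N X p e, X₁ p⟫_ℝ + ⟪X p, tanDeriv S N X₁ p e⟫_ℝ :=
  tanDeriv_bilin_apply hS hN (innerSL ℝ) hp hX hX₁ e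

theorem tanDeriv_smul_apply (hS : IsClosedHypersurface S) (hN : IsUnitNormal S N) {p : Amb n}
    (hp : p ∈ S) {u : Amb n → ℝ} {X : Amb n → F} (hu : DifferentiableWithinAt ℝ u S p)
    (hX : DifferentiableWithinAt ℝ X S p) (e : Amb n) :
    tanDeriv S N (fun x => u x • X x) p e =
      tanDeriv S N u p e • X p + u p • tanDeriv S N X p e :=
  tanDeriv_bilin_apply hS hN (ContinuousLinearMap.lsmul ℝ ℝ) hp hu hX e

theorem tanDeriv_const (hS : IsClosedHypersurface S) (hN : IsUnitNormal S N) {p : Amb n}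
    (hp : p ∈ S) (c : F) : tanDeriv S N (fun _ => c) p = 0 := by
  rw [tanDeriv_of_hasFDerivWithinAt hS hN hp (hasFDerivWithinAt_const c p S)]
  simp

theorem tanDeriv_id (hS : IsClosedHypersurface S) (hN : IsUnitNormal S N) {p : Amb n}
    (hp : p ∈ S) : tanDeriv S N (fun x => x) p = tanProj N p := by
  exact (tanDeriv_of_hasFDerivWithinAt hS hN hp (hasFDerivWithinAt_id p S)).trans
    (ContinuousLinearMap.id_comp _)

theorem IsUnitNormal.differentiableWithinAt (hN : IsUnitNormal S N) {p : Amb n} (hp : p ∈ S) :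
    DifferentiableWithinAt ℝ N S p :=
  hN.contDiffOn.differentiableOn (by simp) p hp

/-- The derivative of a tangent field has normal component given by the shape operator. -/
theorem inner_normal_tanDeriv (hS : IsClosedHypersurface S) (hN : IsUnitNormal S N) {p : Amb n}
    (hp : p ∈ S) {X : Amb n → Amb n} (hX : DifferentiableWithinAt ℝ X S p)
    (hXN : ∀ x ∈ S, ⟪N x, X x⟫_ℝ = 0) (e : Amb n) :
    ⟪N p, tanDeriv S N X p e⟫_ℝ = -⟪tanDeriv S N N p e, X p⟫_ℝ := by
  have h := tanDeriv_inner_apply hS hN hp (hN.differentiableWithinAt hp) hX e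
  rw [tanDeriv_congr (X₁ := fun _ => (0 : ℝ)) hp hXN, tanDeriv_const hS hN hp] at h
  simp only [zero_apply] at h
  linarith

theorem inner_normal_tanDeriv_normal (hS : IsClosedHypersurface S) (hN : IsUnitNormal S N)
    {p : Amb n} (hp : p ∈ S) (e : Amb n) : ⟪N p, tanDeriv S N N p e⟫_ℝ = 0 := by
  have h := tanDeriv_inner_apply hS hN hp (hN.differentiableWithinAt hp)
    (hN.differentiableWithinAt hp) e
  rw [tanDeriv_congr (X₁ := fun _ => (1 : ℝ)) hp (fun x hx => hN.inner_self hx),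
    tanDeriv_const hS hN hp, real_inner_comm] at h
  simp only [zero_apply] at h
  linarith

/-- The shape operator is symmetric. -/
theorem tanDeriv_normal_symm (hS : IsClosedHypersurface S) (hN : IsUnitNormal S N) {p : Amb n}
    (hp : p ∈ S) (v w : Amb n) :
    ⟪tanDeriv S N N p v, w⟫_ℝ = ⟪v, tanDeriv S N N p w⟫_ℝ := by
  obtain ⟨O, π, hpO, hπ⟩ := exists_isLocalRetraction hS hN hp
  have hπp := hπ.eq_self p hpO hp
  have hπd : ContDiffAt ℝ ∞ π p := hπ.contDiffOn.contDiffAt (hπ.isOpen.mem_nhds hpO)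
  have hsymm : IsSymmSndFDerivAt ℝ π p := hπd.isSymmSndFDerivAt (by
    rw [minSmoothness_of_isRCLikeNormedField]; exact WithTop.coe_le_coe.2 le_top)
  have hd2 : DifferentiableAt ℝ (fderiv ℝ π) p :=
    (hπd.fderiv_right (m := 1) (by exact WithTop.coe_le_coe.2 le_top)).differentiableAt (by simp)
  have hNd : DifferentiableAt ℝ (N ∘ π) p :=
    ((hN.contDiffOn.comp hπ.contDiffOn hπ.mapsTo).contDiffAt
      (hπ.isOpen.mem_nhds hpO)).differentiableAt (by simp)
  have hA : tanDeriv S N N p = (fderiv ℝ (N ∘ π) p).comp (tanProj N p) :=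
    hπ.tanDeriv_eq hN hp hpO (hN.differentiableWithinAt hp).hasFDerivWithinAt
  -- Differentiating ⟨N ∘ π, Dπ w⟩ = 0 in the direction v expresses the second fundamental form by
  -- the second derivative of π, which is symmetric.
  have key : ∀ v w, ⟪N p, v⟫_ℝ = 0 → ⟪N p, w⟫_ℝ = 0 →
      ⟪tanDeriv S N N p v, w⟫_ℝ = -⟪N p, fderiv ℝ (fderiv ℝ π) p v w⟫_ℝ := by
    intro v w hv hw
    have h1 := (hNd.hasFDerivAt.inner ℝ ((hd2.hasFDerivAt).clm_apply (hasFDerivAt_const w p)))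
    have h2 : HasFDerivAt (fun x => ⟪(N ∘ π) x, fderiv ℝ π x w⟫_ℝ) (0 : Amb n →L[ℝ] ℝ) p := by
      refine (hasFDerivAt_const (0 : ℝ) p).congr_of_eventuallyEq ?_
      filter_upwards [hπ.isOpen.mem_nhds hpO] with x hx
      exact hπ.inner_fderiv x hx w
    have h3 := congrArg (fun T : Amb n →L[ℝ] ℝ => T v) (h1.unique h2)
    simp [hπp, hπ.fderiv_tangent p hpO hp w hw] at h3
    rw [hA]
    simp only [ContinuousLinearMap.comp_apply, tanProj_of_inner_eq_zero hv]
    linarith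
  have hv : tanDeriv S N N p v = tanDeriv S N N p (tanProj N p v) := by
    rw [tanProj_apply, map_sub, map_smul, hN.tanDeriv_normal hp]; simp
  have hw : tanDeriv S N N p w = tanDeriv S N N p (tanProj N p w) := by
    rw [tanProj_apply, map_sub, map_smul, hN.tanDeriv_normal hp]; simp
  have hn := fun e => inner_normal_tanDeriv_normal hS hN hp e
  have e1 : ⟪tanDeriv S N N p v, w⟫_ℝ = ⟪tanDeriv S N N p v, tanProj N p w⟫_ℝ := by
    rw [tanProj_apply, inner_sub_right, inner_smul_right, real_inner_comm (N p), hn]; simp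
  have e2 : ⟪v, tanDeriv S N N p w⟫_ℝ = ⟪tanProj N p v, tanDeriv S N N p w⟫_ℝ := by
    rw [tanProj_apply, inner_sub_left, inner_smul_left, hn]; simp
  rw [e1, e2, hv, hw, key _ _ (hN.inner_tanProj hp v) (hN.inner_tanProj hp w),
    real_inner_comm (tanDeriv S N N p (tanProj N p w)),
    key _ _ (hN.inner_tanProj hp w) (hN.inner_tanProj hp v), hsymm.eq]

end Calculus

/-! ### Uniform Taylor estimates along the zero section -/

section Parametrized
variable {E Z G : Type*} [NormedAddCommGroup E] [NormedSpace ℝ E] [NormedAddCommGroup Z]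
  [NormedSpace ℝ Z] [NormedAddCommGroup G] [NormedSpace ℝ G]

/-- A function that is `C^1` at the points `(a, 0)`, `a ∈ K`, is Lipschitz in the second variable,
uniformly over the compact set `K`. -/
theorem exists_uniform_lipschitz {F : E × Z → G} {K : Set E} (hK : IsCompact K)
    (hF : ∀ a ∈ K, ContDiffAt ℝ 1 F (a, 0)) :
    ∃ C ε : ℝ, 0 ≤ C ∧ 0 < ε ∧ ∀ a ∈ K, ∀ z z', ‖z‖ ≤ ε → ‖z'‖ ≤ ε →
      ‖F (a, z) - F (a, z')‖ ≤ C * ‖z - z'‖ := by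
  refine hK.induction_on (p := fun s => ∃ C ε : ℝ, 0 ≤ C ∧ 0 < ε ∧ ∀ a ∈ s, ∀ z z', ‖z‖ ≤ ε →
    ‖z'‖ ≤ ε → ‖F (a, z) - F (a, z')‖ ≤ C * ‖z - z'‖) ?_ ?_ ?_ ?_
  · exact ⟨0, 1, le_rfl, one_pos, by simp⟩
  · rintro s t hst ⟨C, ε, hC, hε, h⟩
    exact ⟨C, ε, hC, hε, fun a ha => h a (hst ha)⟩
  · rintro s t ⟨C, ε, hC, hε, h⟩ ⟨C', ε', hC', hε', h'⟩
    refine ⟨max C C', min ε ε', hC.trans (le_max_left _ _), lt_min hε hε', ?_⟩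
    rintro a (ha | ha) z z' hz hz'
    · refine (h a ha z z' (hz.trans (min_le_left _ _)) (hz'.trans (min_le_left _ _))).trans ?_
      gcongr
      exact le_max_left _ _
    · refine (h' a ha z z' (hz.trans (min_le_right _ _)) (hz'.trans (min_le_right _ _))).trans ?_
      gcongr
      exact le_max_right _ _
  · intro a ha
    obtain ⟨C, t, ht, hL⟩ := (hF a ha).exists_lipschitzOnWith
    obtain ⟨δ, hδ, hball⟩ := Metric.mem_nhds_iff.1 ht
    refine ⟨Metric.ball a δ, mem_nhdsWithin_of_mem_nhds (Metric.ball_mem_nhds a hδ),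
      C, δ / 2, C.2, by positivity, ?_⟩
    intro b hb z z' hz hz'
    have hmem : ∀ z : Z, ‖z‖ ≤ δ / 2 → (b, z) ∈ t := by
      intro z hz
      refine hball ?_
      rw [← ball_prod_same]
      exact ⟨hb, by rw [mem_ball_zero_iff]; linarith⟩
    have := hL.dist_le_mul _ (hmem z hz) _ (hmem z' hz')
    rw [dist_eq_norm, dist_eq_norm] at this
    simpa [Prod.norm_def] using this

theorem exists_uniform_mem {X Y : Type*} [TopologicalSpace X] [NormedAddCommGroup Y]
    {Ω : Set (X × Y)} (hΩ : IsOpen Ω) {K : Set X} (hK : IsCompact K)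
    (h0 : ∀ a ∈ K, (a, (0 : Y)) ∈ Ω) :
    ∃ ε : ℝ, 0 < ε ∧ ∀ a ∈ K, ∀ z, ‖z‖ ≤ ε → (a, z) ∈ Ω := by
  obtain ⟨u, v, -, hv, hu, h0v, huv⟩ := generalized_tube_lemma hK
    (isCompact_singleton (x := (0 : Y))) hΩ
    (by rintro ⟨a, z⟩ ⟨ha, hz⟩; rw [mem_singleton_iff] at hz; subst hz; exact h0 a ha)
  obtain ⟨δ, hδ, hball⟩ := Metric.isOpen_iff.1 hv 0 (h0v rfl)
  refine ⟨δ / 2, by positivity, fun a ha z hz => huv ⟨hu ha, hball ?_⟩⟩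
  rw [mem_ball_zero_iff]; linarith

/-- A function of `(a, z)` whose `z`-derivative vanishes at `z = 0` is quadratically close to
constant in `z`. -/
theorem exists_uniform_quadratic {F : E × Z → G} {Ω : Set (E × Z)} (hΩ : IsOpen Ω)
    (hF : ContDiffOn ℝ ∞ F Ω) {K : Set E} (hK : IsCompact K) (h0 : ∀ a ∈ K, (a, (0 : Z)) ∈ Ω)
    (hD : ∀ a ∈ K, ∀ ζ : Z, fderiv ℝ F (a, 0) (0, ζ) = 0) :
    ∃ C ε : ℝ, 0 ≤ C ∧ 0 < ε ∧ ∀ a ∈ K, ∀ z z', ‖z‖ ≤ ε → ‖z'‖ ≤ ε →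
      ‖F (a, z) - F (a, z')‖ ≤ C * (‖z‖ + ‖z'‖) * ‖z - z'‖ := by
  obtain ⟨C, ε₁, hC, hε₁, hlip⟩ := exists_uniform_lipschitz hK
    (F := fun x => (fderiv ℝ F x).comp (ContinuousLinearMap.inr ℝ E Z)) (fun a ha =>
      ((hF.contDiffAt (hΩ.mem_nhds (h0 a ha))).fderiv_right (m := 1)
        (WithTop.coe_le_coe.2 le_top)).clm_comp contDiffAt_const)
  obtain ⟨ε₂, hε₂, hmem⟩ := exists_uniform_mem hΩ hK h0
  refine ⟨C, min ε₁ ε₂, hC, lt_min hε₁ hε₂, fun a ha z z' hz hz' => ?_⟩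
  -- The z-derivative is Lipschitz and zero at z = 0, so it is at most C r on the ball of radius r =
  -- max(‖z‖, ‖z'‖); the mean value inequality on this convex ball concludes.
  have hD0 : (fderiv ℝ F (a, 0)).comp (ContinuousLinearMap.inr ℝ E Z) = 0 := by
    ext ζ
    simpa using hD a ha ζ
  set r := max ‖z‖ ‖z'‖ with hr
  have hrε : r ≤ min ε₁ ε₂ := max_le hz hz'
  have hr' : r ≤ ‖z‖ + ‖z'‖ :=
    max_le (le_add_of_nonneg_right (norm_nonneg _)) (le_add_of_nonneg_left (norm_nonneg _))
  have hder : ∀ y ∈ Metric.closedBall (0 : Z) r, HasFDerivWithinAt (fun y => F (a, y))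
      ((fderiv ℝ F (a, y)).comp (ContinuousLinearMap.inr ℝ E Z)) (Metric.closedBall 0 r) y := by
    intro y hy
    rw [mem_closedBall_zero_iff] at hy
    have h1 := ((hF.contDiffAt (hΩ.mem_nhds (hmem a ha y
      (hy.trans (hrε.trans (min_le_right _ _)))))).differentiableAt (by simp)).hasFDerivAt
    exact (h1.comp y (hasFDerivAt_prodMk_right a y)).hasFDerivWithinAt
  have hbd : ∀ y ∈ Metric.closedBall (0 : Z) r,
      ‖(fderiv ℝ F (a, y)).comp (ContinuousLinearMap.inr ℝ E Z)‖ ≤ C * r := by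
    intro y hy
    rw [mem_closedBall_zero_iff] at hy
    have := hlip a ha y 0 (hy.trans (hrε.trans (min_le_left _ _))) (by simpa using hε₁.le)
    rw [hD0, sub_zero, sub_zero] at this
    exact this.trans (by gcongr)
  have := (convex_closedBall (0 : Z) r).norm_image_sub_le_of_norm_hasFDerivWithin_le hder hbd
    (x := z') (y := z) (by simp [hr]) (by simp [hr])
  exact this.trans (by gcongr)

/-- Uniform estimates for a function that vanishes to second order along `z = 0`. -/
theorem exists_uniform_second_order {F : E × Z → G} {Ω : Set (E × Z)} (hΩ : IsOpen Ω)
    (hF : ContDiffOn ℝ ∞ F Ω) (h0 : ∀ a, (a, (0 : Z)) ∈ Ω)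
    (hD : ∀ a, fderiv ℝ F (a, 0) = 0) {K : Set E} (hK : IsCompact K) :
    ∃ C ε : ℝ, 0 ≤ C ∧ 0 < ε ∧ ∀ a ∈ K, ∀ z z', ‖z‖ ≤ ε → ‖z'‖ ≤ ε →
      (a, z) ∈ Ω ∧
      ‖F (a, z) - F (a, z')‖ ≤ C * (‖z‖ + ‖z'‖) * ‖z - z'‖ ∧
      ‖fderiv ℝ F (a, z) - fderiv ℝ F (a, z')‖ ≤ C * ‖z - z'‖ ∧
      ‖(fderiv ℝ F (a, z) - fderiv ℝ F (a, z')).comp (ContinuousLinearMap.inl ℝ E Z)‖ ≤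
        C * (‖z‖ + ‖z'‖) * ‖z - z'‖ := by
  have hF' : ContDiffOn ℝ ∞ (fderiv ℝ F) Ω := hF.fderiv_of_isOpen hΩ (by exact le_rfl)
  have hat : ∀ a, ContDiffAt ℝ ∞ F (a, 0) := fun a => hF.contDiffAt (hΩ.mem_nhds (h0 a))
  have hat' : ∀ a, ContDiffAt ℝ ∞ (fderiv ℝ F) (a, 0) := fun a =>
    hF'.contDiffAt (hΩ.mem_nhds (h0 a))
  obtain ⟨ε₀, hε₀, hmem⟩ := exists_uniform_mem hΩ hK (fun a _ => h0 a)
  obtain ⟨C₁, ε₁, hC₁, hε₁, h₁⟩ := exists_uniform_quadratic hΩ hF hK (fun a _ => h0 a)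
    (fun a _ ζ => by simp [hD a])
  obtain ⟨C₂, ε₂, hC₂, hε₂, h₂⟩ := exists_uniform_lipschitz hK
    (F := fderiv ℝ F) (fun a _ => (hat' a).of_le (WithTop.coe_le_coe.2 le_top))
  have hT : ContDiffOn ℝ ∞ (fun x => (fderiv ℝ F x).comp (ContinuousLinearMap.inl ℝ E Z)) Ω :=
    hF'.clm_comp contDiffOn_const
  -- The partial derivative of F in a also has vanishing z-derivative at z = 0: by symmetry of the
  -- second derivative this mixed derivative is an a-derivative of a ↦ DF(a, 0), which is
  -- identically zero.
  obtain ⟨C₃, ε₃, hC₃, hε₃, h₃⟩ := exists_uniform_quadratic hΩ hT hK (fun a _ => h0 a) (by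
    intro a _ ζ
    have hd := ((hat' a).differentiableAt (by simp)).hasFDerivAt
    have h1 := hd.clm_comp (hasFDerivAt_const (ContinuousLinearMap.inl ℝ E Z) (a, (0 : Z)))
    rw [h1.fderiv]
    have h2 : HasFDerivAt (fun b : E => fderiv ℝ F (b, 0)) _ a :=
      HasFDerivAt.comp a hd (hasFDerivAt_prodMk_left a (0 : Z))
    have h3 : HasFDerivAt (fun b : E => fderiv ℝ F (b, 0)) (0 : E →L[ℝ] _) a := by
      simp only [hD]
      exact hasFDerivAt_const _ a
    have h4 := h2.unique h3
    have hsymm : IsSymmSndFDerivAt ℝ F (a, 0) := (hat a).isSymmSndFDerivAt (by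
      rw [minSmoothness_of_isRCLikeNormedField]; exact WithTop.coe_le_coe.2 le_top)
    ext e
    have h5 := congrArg (fun T : E →L[ℝ] (E × Z →L[ℝ] G) => T e (0, ζ)) h4
    simp at h5
    simp [hsymm.eq (0, ζ) (e, 0), h5])
  refine ⟨max C₁ (max C₂ C₃), min (min ε₀ ε₁) (min ε₂ ε₃), hC₁.trans (le_max_left _ _),
    by positivity, fun a ha z z' hz hz' => ?_⟩
  simp only [le_min_iff] at hz hz'
  refine ⟨hmem a ha z hz.1.1, ?_, ?_, ?_⟩
  · refine (h₁ a ha z z' hz.1.2 hz'.1.2).trans ?_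
    gcongr; exact le_max_left _ _
  · refine (h₂ a ha z z' hz.2.1 hz'.2.1).trans ?_
    gcongr; exact (le_max_left _ _).trans (le_max_right _ _)
  · refine le_trans (le_of_eq ?_) ((h₃ a ha z z' hz.2.2 hz'.2.2).trans ?_)
    · rw [ContinuousLinearMap.sub_comp]
    · gcongr; exact (le_max_right _ _).trans (le_max_right _ _)

/-- Uniform estimates for the composition of a function vanishing to second order along `z = 0`
with functions on a hypersurface. -/
theorem exists_second_order_bounds {S : Set (Amb n)} {N : Amb n → Amb n}
    (hS : IsClosedHypersurface S) (hN : IsUnitNormal S N) {F : E × Z → G} {Ω : Set (E × Z)}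
    (hΩ : IsOpen Ω) (hF : ContDiffOn ℝ ∞ F Ω) (h0 : ∀ a, (a, (0 : Z)) ∈ Ω)
    (hD : ∀ a, fderiv ℝ F (a, 0) = 0) {α : Amb n → E} (hα : ContDiffOn ℝ ∞ α S) :
    ∃ C ε : ℝ, 0 ≤ C ∧ 0 < ε ∧ ∀ z z' : Amb n → Z, ∀ p ∈ S, ‖z p‖ ≤ ε → ‖z' p‖ ≤ ε →
      DifferentiableWithinAt ℝ z S p → DifferentiableWithinAt ℝ z' S p →
      (α p, z p) ∈ Ω ∧
      ‖F (α p, z p) - F (α p, z' p)‖ ≤ C * (‖z p‖ + ‖z' p‖) * ‖z p - z' p‖ ∧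
      ‖tanDeriv S N (fun x => F (α x, z x)) p - tanDeriv S N (fun x => F (α x, z' x)) p‖ ≤
        C * (‖z p‖ + ‖z' p‖) * ‖z p - z' p‖ + C * ‖z p - z' p‖ * ‖tanDeriv S N z p‖ +
          C * ‖z' p‖ * ‖tanDeriv S N z p - tanDeriv S N z' p‖ := by
  obtain ⟨C, ε, hC, hε, h⟩ := exists_uniform_second_order hΩ hF h0 hD
    (hS.isCompact.image_of_continuousOn hα.continuousOn)
  have hα' : ContinuousOn (tanDeriv S N α) S :=
    (contDiffOn_tanDeriv hS hN (m := ∞) (k := ∞) le_rfl le_rfl hα).continuousOn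
  obtain ⟨M, hM⟩ := hS.isCompact.exists_bound_of_continuousOn hα'
  refine ⟨C * (1 + |M|), ε, by positivity, hε, fun z z' p hp hz hz' hdz hdz' => ?_⟩
  obtain ⟨hm, h1, h2, h3⟩ := h (α p) (mem_image_of_mem _ hp) _ _ hz hz'
  have hm' := (h (α p) (mem_image_of_mem _ hp) _ _ hz' hz).1
  -- Comparison with z = 0, where DF vanishes, gives ‖DF(α, z')‖ ≤ C‖z'‖.
  have h4 := (h (α p) (mem_image_of_mem _ hp) _ 0 hz' (by simpa using hε.le)).2.2.1
  rw [hD, sub_zero, sub_zero] at h4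
  have hCM : C ≤ C * (1 + |M|) := le_mul_of_one_le_right hC (by linarith [abs_nonneg M])
  refine ⟨hm, h1.trans (by gcongr), ?_⟩
  have hαd : DifferentiableWithinAt ℝ α S p := hα.differentiableOn (by simp) p hp
  have key : ∀ y : Amb n → Z, DifferentiableWithinAt ℝ y S p → (α p, y p) ∈ Ω →
      tanDeriv S N (fun x => F (α x, y x)) p =
        (fderiv ℝ F (α p, y p)).comp ((tanDeriv S N α p).prod (tanDeriv S N y p)) := by
    intro y hy hyΩ
    rw [← tanDeriv_prodMk hS hN hp hαd hy]
    exact tanDeriv_comp hS hN hp (hαd.prodMk hy)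
      ((hF.contDiffAt (hΩ.mem_nhds hyΩ)).differentiableAt (by simp)).hasFDerivAt
  rw [key z hdz hm, key z' hdz' hm']
  -- The change of DF acts on Dα, where it is quadratic, and on Dz, where it is only Lipschitz; the
  -- small operator DF(α, z') acts on Dz - Dz'. These are the three terms of the bound.
  have hdec : (fderiv ℝ F (α p, z p)).comp ((tanDeriv S N α p).prod (tanDeriv S N z p)) -
      (fderiv ℝ F (α p, z' p)).comp ((tanDeriv S N α p).prod (tanDeriv S N z' p)) =
      ((fderiv ℝ F (α p, z p) - fderiv ℝ F (α p, z' p)).comp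
        (ContinuousLinearMap.inl ℝ E Z)).comp (tanDeriv S N α p) +
      (fderiv ℝ F (α p, z p) - fderiv ℝ F (α p, z' p)).comp
        ((ContinuousLinearMap.inr ℝ E Z).comp (tanDeriv S N z p)) +
      (fderiv ℝ F (α p, z' p)).comp
        ((ContinuousLinearMap.inr ℝ E Z).comp (tanDeriv S N z p - tanDeriv S N z' p)) := by
    have hsplit : ∀ (T : E × Z →L[ℝ] G) (a : E) (b : Z), T (a, b) = T (a, 0) + T (0, b) := by
      intro T a b
      rw [← map_add]; simp
    ext e
    simp only [sub_apply, add_apply, ContinuousLinearMap.comp_apply, ContinuousLinearMap.prod_apply,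
      ContinuousLinearMap.inl_apply, ContinuousLinearMap.inr_apply]
    rw [hsplit (fderiv ℝ F (α p, z p)), hsplit (fderiv ℝ F (α p, z' p))]
    have : ((0 : E), (tanDeriv S N z p) e - (tanDeriv S N z' p) e) =
      (0, tanDeriv S N z p e) - (0, tanDeriv S N z' p e) := by simp
    rw [this, map_sub]
    abel
  have hinr : ∀ T : Amb n →L[ℝ] Z, ‖(ContinuousLinearMap.inr ℝ E Z).comp T‖ ≤ ‖T‖ := by
    intro T
    refine ContinuousLinearMap.opNorm_le_bound _ (norm_nonneg _) (fun e => ?_)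
    simpa [Prod.norm_def] using T.le_opNorm e
  rw [hdec]
  have hMp : ‖tanDeriv S N α p‖ ≤ 1 + |M| := ((hM p hp).trans (le_abs_self M)).trans (by linarith)
  refine (norm_add₃_le).trans (add_le_add_three ?_ ?_ ?_)
  · refine (ContinuousLinearMap.opNorm_comp_le _ _).trans ?_
    calc _ ≤ (C * (‖z p‖ + ‖z' p‖) * ‖z p - z' p‖) * (1 + |M|) := by gcongr
      _ = _ := by ring
  · refine (ContinuousLinearMap.opNorm_comp_le _ _).trans ?_
    calc _ ≤ (C * ‖z p - z' p‖) * ‖tanDeriv S N z p‖ := by gcongr; exact hinr _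
      _ ≤ _ := by gcongr
  · refine (ContinuousLinearMap.opNorm_comp_le _ _).trans ?_
    calc _ ≤ (C * ‖z' p‖) * ‖tanDeriv S N z p - tanDeriv S N z' p‖ := by gcongr; exact hinr _
      _ ≤ _ := by gcongr

end Parametrized

/-! ### Linear algebra of the graph: traces and resolvents -/

section LinearAlgebra

/-- The trace as a continuous linear functional on endomorphisms. -/
def opTrace (n : ℕ) : (Amb n →L[ℝ] Amb n) →L[ℝ] ℝ :=
  LinearMap.toContinuousLinearMap
    (LinearMap.trace ℝ (Amb n) ∘ₗ ContinuousLinearMap.coeLM ℝ)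

theorem opTrace_apply (T : Amb n →L[ℝ] Amb n) :
    opTrace n T = LinearMap.trace ℝ (Amb n) (T : Amb n →ₗ[ℝ] Amb n) := rfl

theorem opTrace_mul_comm (T T' : Amb n →L[ℝ] Amb n) : opTrace n (T * T') = opTrace n (T' * T) :=
  LinearMap.trace_mul_comm ℝ (T : Amb n →ₗ[ℝ] Amb n) (T' : Amb n →ₗ[ℝ] Amb n)

theorem opTrace_smulRight (l : Amb n →L[ℝ] ℝ) (x : Amb n) : opTrace n (l.smulRight x) = l x :=
  LinearMap.trace_smulRight (l : Amb n →ₗ[ℝ] ℝ) x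

theorem opTrace_mul_self {A : Amb n →L[ℝ] Amb n} (hA : ∀ v w, ⟪A v, w⟫_ℝ = ⟪v, A w⟫_ℝ) :
    opTrace n (A * A) = hsNorm A ^ 2 := by
  rw [hsNorm, Real.sq_sqrt (Finset.sum_nonneg fun i _ => sq_nonneg _), opTrace_apply,
    LinearMap.trace_eq_sum_inner _ (EuclideanSpace.basisFun (Fin (n + 1)) ℝ)]
  refine Finset.sum_congr rfl fun i _ => ?_
  rw [← real_inner_self_eq_norm_sq, hA]
  rfl

/-- `(1 + sA)⁻¹`. -/
def resolventOp (A : Amb n →L[ℝ] Amb n) (s : ℝ) : Amb n →L[ℝ] Amb n :=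
  Ring.inverse (1 + s • A)

variable {A R D : Amb n →L[ℝ] Amb n} {s : ℝ}

theorem mul_resolventOp (h : IsUnit (1 + s • A)) (v : Amb n) :
    resolventOp A s v + s • A (resolventOp A s v) = v :=
  congrArg (fun T : Amb n →L[ℝ] Amb n => T v) (Ring.mul_inverse_cancel _ h)

theorem resolventOp_mul (h : IsUnit (1 + s • A)) (v : Amb n) :
    resolventOp A s (v + s • A v) = v :=
  congrArg (fun T : Amb n →L[ℝ] Amb n => T v) (Ring.inverse_mul_cancel _ h)

theorem resolventOp_symm (h : IsUnit (1 + s • A)) (hA : ∀ v w, ⟪A v, w⟫_ℝ = ⟪v, A w⟫_ℝ)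
    (v w : Amb n) : ⟪resolventOp A s v, w⟫_ℝ = ⟪v, resolventOp A s w⟫_ℝ := by
  conv_lhs => rw [← mul_resolventOp h w]
  conv_rhs => rw [← mul_resolventOp h v]
  simp only [inner_add_left, inner_add_right, inner_smul_left, inner_smul_right, hA]
  simp

theorem resolventOp_of_eq_zero (h : IsUnit (1 + s • A)) {ν : Amb n} (hν : A ν = 0) :
    resolventOp A s ν = ν := by
  simpa [hν] using resolventOp_mul h ν

/-- The trace computing the mean curvature of a graph, in terms of the shape operator `A`, the
height `s`, the gradient `y` and the derivative `D` of `Y = (1 + sA)⁻¹ ∇u`. -/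
theorem trace_graph (h : IsUnit (1 + s • A)) (hA : ∀ v w, ⟪A v, w⟫_ℝ = ⟪v, A w⟫_ℝ)
    {ν y Y m : Amb n} (hν : ⟪ν, ν⟫_ℝ = 1) (hAν : A ν = 0) (hy : ⟪ν, y⟫_ℝ = 0)
    (hY : Y = resolventOp A s y) (hDν : D ν = 0) (hD : ∀ e, ⟪ν, D e⟫_ℝ = -⟪A e, Y⟫_ℝ)
    {w : ℝ} (hw : 0 < w) (hw2 : w ^ 2 = 1 + ⟪Y, Y⟫_ℝ) (hm : m = w⁻¹ • (ν - Y))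
    {c : Amb n →L[ℝ] ℝ} (hc : c ν = 0) {Fr Dm : Amb n →L[ℝ] Amb n}
    (hFr : ∀ e, Fr e = e - ⟪ν, e⟫_ℝ • ν + s • A e + ⟪y, e⟫_ℝ • ν + ⟪ν, e⟫_ℝ • m)
    (hDm : ∀ e, Dm e = c e • (ν - Y) + w⁻¹ • (A e - D e)) :
    w * opTrace n (Dm.comp (ContinuousLinearMap.inverse Fr)) =
      opTrace n (resolventOp A s * A) - opTrace n (resolventOp A s * D) +
        (w ^ 2)⁻¹ * ⟪Y, D (resolventOp A s Y)⟫_ℝ := by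
  set R := resolventOp A s with hR
  have hRs := resolventOp_symm h hA
  have hRν : R ν = ν := resolventOp_of_eq_zero h hAν
  have hνY : ⟪ν, Y⟫_ℝ = 0 := by rw [hY, ← hRs, ← hR, hRν, hy]
  have hYν : ⟪Y, ν⟫_ℝ = 0 := by rw [real_inner_comm, hνY]
  have hνR : ∀ e, ⟪ν, R e⟫_ℝ = ⟪ν, e⟫_ℝ := fun e => by rw [← hRs, ← hR, hRν]
  have hyR : ∀ e, ⟪y, R e⟫_ℝ = ⟪Y, e⟫_ℝ := fun e => by rw [← hRs, ← hR, hY]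
  have hνA : ∀ e, ⟪ν, A e⟫_ℝ = 0 := fun e => by rw [← hA, hAν, inner_zero_left]
  have hyν : ⟪y, ν⟫_ℝ = 0 := by rw [real_inner_comm, hy]
  have hw0 : w ≠ 0 := hw.ne'
  have hYY : ⟪Y, Y⟫_ℝ = w ^ 2 - 1 := by rw [hw2]; ring
  -- The explicit inverse of the frame: on vectors orthogonal to ν - Y it is R followed by removal
  -- of the ν-component, and b is chosen so that it sends ν - Y = w m to w ν.
  set b : Amb n := (w ^ 2)⁻¹ • R Y + w⁻¹ • ν with hb
  set Gi : Amb n →L[ℝ] Amb n := R + (innerSL ℝ (ν - Y)).smulRight b -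
    (innerSL ℝ ν).smulRight ν with hGi
  have hGia : ∀ z, Gi z = R z + ⟪ν - Y, z⟫_ℝ • b - ⟪ν, z⟫_ℝ • ν := fun z => rfl
  have hFrR : ∀ z, Fr (R z) = z - ⟪ν, z⟫_ℝ • ν + ⟪Y, z⟫_ℝ • ν + ⟪ν, z⟫_ℝ • m := by
    intro z
    rw [hFr, hνR, hyR]
    have := mul_resolventOp h z
    rw [← hR] at this
    rw [eq_sub_of_add_eq' this]
    module
  have hFrν : Fr ν = m := by rw [hFr, hν, hAν, hyν]; module
  have hFG : Fr * Gi = 1 := by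
    ext1 z
    show Fr (Gi z) = z
    rw [hGia, map_sub, map_add, map_smul, map_smul, hb, map_add, map_smul, map_smul, hFrR, hFrR,
      hFrν, hνY, hYY, hm, inner_sub_left]
    match_scalars <;> field_simp <;> ring
  have hGF : Gi * Fr = 1 := by
    have h1 : (Fr : Amb n →ₗ[ℝ] Amb n) * (Gi : Amb n →ₗ[ℝ] Amb n) = 1 := by
      ext1 z
      exact congrArg (fun T : Amb n →L[ℝ] Amb n => T z) hFG
    have h2 := mul_eq_one_comm.1 h1
    ext1 z
    exact congrArg (fun T : Amb n →ₗ[ℝ] Amb n => T z) h2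
  have hinv : ContinuousLinearMap.inverse Fr = Gi := ContinuousLinearMap.inverse_eq hFG hGF
  have hGn : Gi (ν - Y) = w • ν := by
    have : ⟪ν - Y, ν - Y⟫_ℝ = w ^ 2 := by
      rw [inner_sub_left, inner_sub_right, inner_sub_right, hν, hνY, hYν, hYY]; ring
    rw [hGia, this, inner_sub_right, hν, hνY, hb, map_sub, hRν]
    match_scalars <;> field_simp <;> ring
  -- Two terms have rank one. The term with c, which carries the derivative of w⁻¹, has trace c(Gi(ν
  -- - Y)) = w c(ν) = 0.
  have hDmG : Dm.comp Gi = (c.comp Gi).smulRight (ν - Y) + w⁻¹ • ((A - D) * R) +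
      (innerSL ℝ (ν - Y)).smulRight (w⁻¹ • ((w ^ 2)⁻¹ • (A (R Y) - D (R Y)))) := by
    ext1 z
    show Dm (Gi z) = c (Gi z) • (ν - Y) + w⁻¹ • (A (R z) - D (R z)) +
      ⟪ν - Y, z⟫_ℝ • (w⁻¹ • ((w ^ 2)⁻¹ • (A (R Y) - D (R Y))))
    rw [hDm, hGia]
    have e1 : A (R z + ⟪ν - Y, z⟫_ℝ • b - ⟪ν, z⟫_ℝ • ν) =
        A (R z) + ⟪ν - Y, z⟫_ℝ • ((w ^ 2)⁻¹ • A (R Y)) := by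
      rw [map_sub, map_add, map_smul, map_smul, hb, map_add, map_smul, map_smul, hAν]; simp
    have e2 : D (R z + ⟪ν - Y, z⟫_ℝ • b - ⟪ν, z⟫_ℝ • ν) =
        D (R z) + ⟪ν - Y, z⟫_ℝ • ((w ^ 2)⁻¹ • D (R Y)) := by
      rw [map_sub, map_add, map_smul, map_smul, hb, map_add, map_smul, map_smul, hDν]; simp
    rw [e1, e2]
    module
  rw [hinv, hDmG, map_add, map_add, opTrace_smulRight, opTrace_smulRight, map_smul,
    ContinuousLinearMap.comp_apply, hGn, map_smul, hc, opTrace_mul_comm (A - D), mul_sub, map_sub]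
  -- The normal part of D(RY) is -⟨A(RY), Y⟩, which cancels the contribution of A.
  have e3 : ⟪ν - Y, A (R Y) - D (R Y)⟫_ℝ = ⟪Y, D (R Y)⟫_ℝ := by
    rw [inner_sub_left, inner_sub_right, inner_sub_right, hνA, hD, real_inner_comm Y (A (R Y))]
    ring
  rw [innerSL_apply_apply, inner_smul_right, inner_smul_right, e3]
  simp only [smul_eq_mul]
  field_simp
  ring

end LinearAlgebra

/-! ### The unit normal of a graph and the derivative of the resolvent -/

section Graph
variable {S : Set (Amb n)} {N : Amb n → Amb n} {u : Amb n → ℝ}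

/-- The resolvent `(1 + uA)⁻¹` of the shape operator at the height `u`. -/
def graphRes (S : Set (Amb n)) (N : Amb n → Amb n) (u : Amb n → ℝ) (p : Amb n) :
    Amb n →L[ℝ] Amb n :=
  resolventOp (tanDeriv S N N p) (u p)

/-- The field `Y = (1 + uA)⁻¹ ∇u`; the vector `N - Y` is normal to the graph of `u`. -/
def graphSlope (S : Set (Amb n)) (N : Amb n → Amb n) (u : Amb n → ℝ) (p : Amb n) : Amb n :=
  graphRes S N u p (tanGrad S N u p)

/-- `√(1 + |Y|²)`. -/
def graphSpeed (S : Set (Amb n)) (N : Amb n → Amb n) (u : Amb n → ℝ) (p : Amb n) : ℝ :=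
  √(1 + ⟪graphSlope S N u p, graphSlope S N u p⟫_ℝ)

theorem graphSpeed_sq (p : Amb n) :
    graphSpeed S N u p ^ 2 = 1 + ⟪graphSlope S N u p, graphSlope S N u p⟫_ℝ :=
  Real.sq_sqrt (add_nonneg zero_le_one real_inner_self_nonneg)

theorem graphSpeed_pos (p : Amb n) : 0 < graphSpeed S N u p :=
  Real.sqrt_pos.2 (add_pos_of_pos_of_nonneg one_pos real_inner_self_nonneg)

variable {p : Amb n}

theorem tanDeriv_graphMap (hS : IsClosedHypersurface S) (hN : IsUnitNormal S N) (hp : p ∈ S)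
    (hu : DifferentiableWithinAt ℝ u S p) (e : Amb n) :
    tanDeriv S N (graphMap N u) p e = e - ⟪N p, e⟫_ℝ • N p + u p • tanDeriv S N N p e +
      ⟪tanGrad S N u p, e⟫_ℝ • N p := by
  have h := congrArg (fun T : Amb n →L[ℝ] Amb n => T e)
    (tanDeriv_add hS hN hp (X := fun x => x) (X₁ := fun x => u x • N x)
      differentiableWithinAt_id (hu.smul (hN.differentiableWithinAt hp)))
  have h' : tanDeriv S N (graphMap N u) p e = _ := h
  rw [h', add_apply, tanDeriv_id hS hN hp, tanProj_apply,
    tanDeriv_smul_apply hS hN hp hu (hN.differentiableWithinAt hp), inner_tanGrad]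
  module

theorem inner_normal_graphSlope (hS : IsClosedHypersurface S) (hN : IsUnitNormal S N) (hp : p ∈ S)
    (h : IsUnit (1 + u p • tanDeriv S N N p)) : ⟪N p, graphSlope S N u p⟫_ℝ = 0 := by
  rw [graphSlope, graphRes, ← resolventOp_symm h (tanDeriv_normal_symm hS hN hp),
    resolventOp_of_eq_zero h (hN.tanDeriv_normal hp N), hN.inner_tanGrad_normal hp]

/-- A tangent vector e is mapped to (1 + uA)e + ⟨∇u, e⟩N, whose product with N - Y is ⟨∇u, e⟩ - ⟨(1
+ uA)Y, e⟩ = 0. Thus N - Y spans the normal line, and the projection of N to it is w⁻²(N - Y). -/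
theorem graphNormal_eq (hS : IsClosedHypersurface S) (hN : IsUnitNormal S N) (hp : p ∈ S)
    (hu : DifferentiableWithinAt ℝ u S p) (h : IsUnit (1 + u p • tanDeriv S N N p)) :
    graphNormal S N u p = (graphSpeed S N u p)⁻¹ • (N p - graphSlope S N u p) := by
  set Y := graphSlope S N u p with hY
  set w := graphSpeed S N u p with hw
  set R := graphRes S N u p with hR
  have hw2 : w ^ 2 = 1 + ⟪Y, Y⟫_ℝ := graphSpeed_sq p
  have hw0 : 0 < w := graphSpeed_pos p
  have hNY : ⟪N p, Y⟫_ℝ = 0 := inner_normal_graphSlope hS hN hp h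
  have hNN := hN.inner_self hp
  have hRs := resolventOp_symm h (tanDeriv_normal_symm hS hN hp)
  have hA := tanDeriv_normal_symm hS hN hp
  have hRY : ∀ v, R v + u p • tanDeriv S N N p (R v) = v := mul_resolventOp h
  have hproj : (LinearMap.range (tanDeriv S N (graphMap N u) p : Amb n →ₗ[ℝ] Amb n))ᗮ.starProjection
      (N p) = (w ^ 2)⁻¹ • (N p - Y) := by
    refine Submodule.eq_starProjection_of_mem_of_inner_eq_zero ?_ ?_
    · refine Submodule.smul_mem _ _ ((Submodule.mem_orthogonal' _ _).2 ?_)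
      rintro _ ⟨e, rfl⟩
      rw [ContinuousLinearMap.coe_coe, tanDeriv_graphMap hS hN hp hu]
      have e1 : ⟪Y, e⟫_ℝ + u p * ⟪Y, tanDeriv S N N p e⟫_ℝ = ⟪tanGrad S N u p, e⟫_ℝ := by
        conv_rhs => rw [← hRY (tanGrad S N u p)]
        rw [inner_add_left, inner_smul_left, hA]; rfl
      simp only [inner_sub_left, inner_add_right, inner_sub_right, inner_smul_right, hNN,
        inner_normal_tanDeriv_normal hS hN hp, real_inner_comm (N p) Y, hNY, ← e1]
      ring
    · intro x hx
      have hmem : N p - (w ^ 2)⁻¹ • (N p - Y) ∈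
          LinearMap.range (tanDeriv S N (graphMap N u) p : Amb n →ₗ[ℝ] Amb n) := by
        -- The differential of the parametrization sends RY to Y + ⟨∇u, RY⟩N = Y + (w² - 1)N.
        refine ⟨(w ^ 2)⁻¹ • R Y, ?_⟩
        rw [ContinuousLinearMap.coe_coe, map_smul, tanDeriv_graphMap hS hN hp hu]
        have e1 : ⟪N p, R Y⟫_ℝ = 0 := by
          rw [hR, graphRes, ← hRs, resolventOp_of_eq_zero h (hN.tanDeriv_normal hp N), hNY]
        have e2 : ⟪tanGrad S N u p, R Y⟫_ℝ = w ^ 2 - 1 := by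
          rw [hR, graphRes, ← hRs, hw2]
          simp [hY, graphSlope, graphRes]
        have e3 : R Y - (0 : ℝ) • N p + u p • tanDeriv S N N p (R Y) = Y := by
          rw [zero_smul, sub_zero, hRY]
        rw [e1, e2, e3]
        match_scalars <;> field_simp
      rw [(Submodule.mem_orthogonal _ _).1 hx _ hmem]
  have hnorm : ‖N p - Y‖ = w := by
    rw [← Real.sqrt_sq hw0.le, hw2, norm_eq_sqrt_real_inner]
    congr 1
    simp only [inner_sub_left, inner_sub_right, hNN, hNY, real_inner_comm (N p) Y]
    ring
  simp only [graphNormal]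
  rw [hproj, norm_smul, hnorm, smul_smul]
  congr 1
  rw [Real.norm_of_nonneg (by positivity)]
  field_simp

/-- This is d(B⁻¹) = -B⁻¹ dB B⁻¹ for B = 1 + uA. -/
theorem tanDeriv_graphRes_apply (hS : IsClosedHypersurface S) (hN : IsUnitNormal S N) (hp : p ∈ S)
    (hu : DifferentiableWithinAt ℝ u S p) (h : IsUnit (1 + u p • tanDeriv S N N p)) (e : Amb n) :
    tanDeriv S N (graphRes S N u) p e = -(graphRes S N u p *
      (⟪tanGrad S N u p, e⟫_ℝ • tanDeriv S N N p + u p • tanDeriv S N (tanDeriv S N N) p e) *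
        graphRes S N u p) := by
  have hAd : DifferentiableWithinAt ℝ (tanDeriv S N N) S p :=
    (contDiffOn_tanDeriv hS hN (m := ∞) (k := ∞) le_rfl le_rfl hN.contDiffOn).differentiableOn
      (by simp) p hp
  have hsm : DifferentiableWithinAt ℝ (fun x => u x • tanDeriv S N N x) S p := hu.smul hAd
  obtain ⟨U, hU⟩ := h
  have hinv := hasFDerivAt_ringInverse (𝕜 := ℝ) U
  have hUinv : (↑U⁻¹ : Amb n →L[ℝ] Amb n) = graphRes S N u p := by
    rw [← Ring.inverse_unit, hU]; rfl
  rw [hU, hUinv] at hinv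
  have h1 : tanDeriv S N (graphRes S N u) p = _ :=
    tanDeriv_comp hS hN hp (X := fun x => 1 + u x • tanDeriv S N N x)
      (Ψ := Ring.inverse) (hsm.const_add 1) hinv
  have h2 : tanDeriv S N (fun x => 1 + u x • tanDeriv S N N x) p e =
      ⟪tanGrad S N u p, e⟫_ℝ • tanDeriv S N N p + u p • tanDeriv S N (tanDeriv S N N) p e := by
    rw [tanDeriv_add hS hN hp (differentiableWithinAt_const _) hsm,
      tanDeriv_const hS hN hp, zero_add, tanDeriv_smul_apply hS hN hp hu hAd, inner_tanGrad]
  rw [h1, ContinuousLinearMap.comp_apply, h2]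
  rfl

end Graph

/-! ### Functions of the jet that vanish to second order -/

section SecondOrder
variable {V : Type*} [NormedAddCommGroup V] [InnerProductSpace ℝ V]

/-- The position, the shape operator and its derivative at a point of a hypersurface. -/
def GeomData (V : Type*) [NormedAddCommGroup V] [InnerProductSpace ℝ V] : Type _ :=
  V × (V →L[ℝ] V) × (V →L[ℝ] V →L[ℝ] V)

instance : NormedAddCommGroup (GeomData V) :=
  inferInstanceAs (NormedAddCommGroup (V × (V →L[ℝ] V) × (V →L[ℝ] V →L[ℝ] V)))

instance : NormedSpace ℝ (GeomData V) :=
  inferInstanceAs (NormedSpace ℝ (V × (V →L[ℝ] V) × (V →L[ℝ] V →L[ℝ] V)))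

namespace GeomData

/-- The position. -/
def pos : GeomData V →L[ℝ] V := ContinuousLinearMap.fst ℝ V ((V →L[ℝ] V) × (V →L[ℝ] V →L[ℝ] V))

/-- The shape operator. -/
def shape : GeomData V →L[ℝ] (V →L[ℝ] V) :=
  (ContinuousLinearMap.fst ℝ (V →L[ℝ] V) (V →L[ℝ] V →L[ℝ] V)).comp
    (ContinuousLinearMap.snd ℝ V ((V →L[ℝ] V) × (V →L[ℝ] V →L[ℝ] V)))

/-- The derivative of the shape operator. -/
def dshape : GeomData V →L[ℝ] (V →L[ℝ] V →L[ℝ] V) :=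
  (ContinuousLinearMap.snd ℝ (V →L[ℝ] V) (V →L[ℝ] V →L[ℝ] V)).comp
    (ContinuousLinearMap.snd ℝ V ((V →L[ℝ] V) × (V →L[ℝ] V →L[ℝ] V)))

end GeomData

/-- The value and the gradient of a function at a point. -/
def Jet (V : Type*) : Type _ := ℝ × V

instance : NormedAddCommGroup (Jet V) := inferInstanceAs (NormedAddCommGroup (ℝ × V))

instance : NormedSpace ℝ (Jet V) := inferInstanceAs (NormedSpace ℝ (ℝ × V))

namespace Jet

/-- The value. -/
def val : Jet V →L[ℝ] ℝ := ContinuousLinearMap.fst ℝ ℝ V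

/-- The gradient. -/
def grad : Jet V →L[ℝ] V := ContinuousLinearMap.snd ℝ ℝ V

end Jet

/-- The resolvent as a function of the geometric data and the jet. -/
def jetRes (x : GeomData V × Jet V) : V →L[ℝ] V :=
  Ring.inverse (1 + Jet.val x.2 • GeomData.shape x.1)

/-- The nonlinear part of the flux `(1 + uA)⁻² ∇u`. -/
def fluxErr (x : GeomData V × Jet V) : V := jetRes x (jetRes x (Jet.grad x.2)) - Jet.grad x.2

/-- Minus the logarithm of the graph speed. -/
def logSpeed (x : GeomData V × Jet V) : ℝ :=
  -(1 / 2) * Real.log (1 + ⟪jetRes x (Jet.grad x.2), jetRes x (Jet.grad x.2)⟫_ℝ)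

/-- The part of the nonlinearity of order at most one, for the trace functional `T`. -/
def lowerOrder (T : (V →L[ℝ] V) →L[ℝ] ℝ) (x : GeomData V × Jet V) : ℝ :=
  Jet.val x.2 * (1 / 2 * ⟪GeomData.pos x.1, (GeomData.shape x.1) (jetRes x (Jet.grad x.2))⟫_ℝ +
    (T ((GeomData.shape x.1) * (jetRes x * (GeomData.shape x.1))) -
        T ((GeomData.shape x.1) * (GeomData.shape x.1))) +
    T (jetRes x * (GeomData.dshape x.1).flip (jetRes x (jetRes x (Jet.grad x.2))))) +
  ⟪Jet.grad x.2, jetRes x ((GeomData.shape x.1) (jetRes x (jetRes x (Jet.grad x.2))))⟫_ℝ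

/-- The set where `1 + sA` is invertible. -/
def regularSet (V : Type*) [NormedAddCommGroup V] [InnerProductSpace ℝ V] :
    Set (GeomData V × Jet V) :=
  {x | IsUnit (1 + Jet.val x.2 • GeomData.shape x.1)}

theorem zero_mem_regularSet (a : GeomData V) : (a, (0 : Jet V)) ∈ regularSet V := by
  simp [regularSet]

theorem jetRes_zero (a : GeomData V) : jetRes (a, (0 : Jet V)) = 1 := by
  simp [jetRes]

theorem contDiff_flip : ContDiff ℝ ∞ (fun D : V →L[ℝ] V →L[ℝ] V => D.flip) :=
  IsBoundedLinearMap.contDiff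
    { map_add := fun _ _ => rfl
      map_smul := fun _ _ => rfl
      bound := ⟨1, one_pos, fun D => by rw [one_mul, ContinuousLinearMap.opNorm_flip]⟩ }

variable [CompleteSpace V]

theorem isOpen_regularSet : IsOpen (regularSet V) :=
  Units.isOpen.preimage
    (f := fun x : GeomData V × Jet V => 1 + Jet.val x.2 • GeomData.shape x.1) (by fun_prop)

theorem contDiffOn_jetRes : ContDiffOn ℝ ∞ (jetRes (V := V)) (regularSet V) := by
  rintro x ⟨U, hU⟩
  have h1 : ContDiffAt ℝ ∞ Ring.inverse (1 + Jet.val x.2 • GeomData.shape x.1) := by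
    rw [← hU]; exact contDiffAt_ringInverse ℝ U
  have h2 : ContDiffAt ℝ ∞ (fun x : GeomData V × Jet V => 1 + Jet.val x.2 • GeomData.shape x.1) x :=
    by fun_prop
  exact (h1.comp x h2).contDiffWithinAt

theorem contDiffOn_jetRes_slope :
    ContDiffOn ℝ ∞ (fun x : GeomData V × Jet V => jetRes x (Jet.grad x.2)) (regularSet V) :=
  contDiffOn_jetRes.clm_apply (by fun_prop)

theorem contDiffOn_fluxErr : ContDiffOn ℝ ∞ (fluxErr (V := V)) (regularSet V) :=
  (contDiffOn_jetRes.clm_apply contDiffOn_jetRes_slope).sub (by fun_prop)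

theorem contDiffOn_logSpeed : ContDiffOn ℝ ∞ (logSpeed (V := V)) (regularSet V) :=
  contDiffOn_const.mul ((contDiffOn_const.add
    (contDiffOn_jetRes_slope.inner ℝ contDiffOn_jetRes_slope)).log
      fun _ _ => (add_pos_of_pos_of_nonneg one_pos real_inner_self_nonneg).ne')

theorem contDiffOn_lowerOrder (T : (V →L[ℝ] V) →L[ℝ] ℝ) :
    ContDiffOn ℝ ∞ (lowerOrder T) (regularSet V) := by
  have hR := contDiffOn_jetRes (V := V)
  have hY := contDiffOn_jetRes_slope (V := V)
  have hZ := hR.clm_apply hY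
  have hA : ContDiffOn ℝ ∞ (fun x : GeomData V × Jet V => GeomData.shape x.1) (regularSet V) := by
    fun_prop
  have hs : ContDiffOn ℝ ∞ (fun x : GeomData V × Jet V => Jet.val x.2) (regularSet V) := by fun_prop
  have hy : ContDiffOn ℝ ∞ (fun x : GeomData V × Jet V => Jet.grad x.2) (regularSet V) := by
    fun_prop
  have hx : ContDiffOn ℝ ∞ (fun x : GeomData V × Jet V => GeomData.pos x.1) (regularSet V) := by
    fun_prop
  have hD :
      ContDiffOn ℝ ∞ (fun x : GeomData V × Jet V => (GeomData.dshape x.1).flip) (regularSet V) :=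
    contDiff_flip.comp_contDiffOn
      (by fun_prop :
          ContDiffOn ℝ ∞ (fun x : GeomData V × Jet V => GeomData.dshape x.1) (regularSet V))
  have hT := T.contDiff (n := ∞)
  exact (hs.mul (((contDiffOn_const.mul (hx.inner ℝ (hA.clm_apply hY))).add
    ((hT.comp_contDiffOn (hA.clm_comp (hR.clm_comp hA))).sub
      (hT.comp_contDiffOn (hA.clm_comp hA)))).add
    (hT.comp_contDiffOn (hR.clm_comp (hD.clm_apply hZ))))).add
    (hy.inner ℝ (hR.clm_apply (hA.clm_apply hZ)))

/-- In the product rule each term keeps an undifferentiated factor, which is zero. The nonlinear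
terms below are reduced to such products. -/
theorem hasFDerivAt_bilin_of_eq_zero {E F G K : Type*} [NormedAddCommGroup E] [NormedSpace ℝ E]
    [NormedAddCommGroup F] [NormedSpace ℝ F] [NormedAddCommGroup G] [NormedSpace ℝ G]
    [NormedAddCommGroup K] [NormedSpace ℝ K] (B : F →L[ℝ] G →L[ℝ] K) {f : E → F} {g : E → G}
    {x : E} (hf : DifferentiableAt ℝ f x) (hg : DifferentiableAt ℝ g x) (hf0 : f x = 0)
    (hg0 : g x = 0) : HasFDerivAt (fun y => B (f y) (g y)) (0 : E →L[ℝ] K) x := by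
  convert! B.hasFDerivAt_of_bilinear hf.hasFDerivAt hg.hasFDerivAt using 1
  ext e
  simp [hf0, hg0]

theorem differentiableAt_of_contDiffOn_regularSet {G : Type*} [NormedAddCommGroup G]
    [NormedSpace ℝ G] {F : GeomData V × Jet V → G} (hF : ContDiffOn ℝ ∞ F (regularSet V))
    (a : GeomData V) : DifferentiableAt ℝ F (a, 0) :=
  (hF.contDiffAt (isOpen_regularSet.mem_nhds (zero_mem_regularSet a))).differentiableAt (by simp)

/-- The error is (R² - 1) applied to the gradient, and both factors vanish at the zero jet because R
= 1 there. -/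
theorem fderiv_fluxErr (a : GeomData V) : fderiv ℝ (fluxErr (V := V)) (a, 0) = 0 := by
  have hR : DifferentiableAt ℝ (fun x : GeomData V × Jet V => jetRes x * jetRes x - 1) (a, 0) :=
    differentiableAt_of_contDiffOn_regularSet
      ((contDiffOn_jetRes.clm_comp contDiffOn_jetRes).sub contDiffOn_const) a
  exact (hasFDerivAt_bilin_of_eq_zero (E := GeomData V × Jet V)
    (ContinuousLinearMap.id ℝ (V →L[ℝ] V)) hR
    (g := fun x => Jet.grad x.2) (by fun_prop) (by simp [jetRes_zero]) rfl).fderiv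

theorem fderiv_logSpeed (a : GeomData V) : fderiv ℝ (logSpeed (V := V)) (a, 0) = 0 := by
  have hY := differentiableAt_of_contDiffOn_regularSet (contDiffOn_jetRes_slope (V := V)) a
  have h1 := hasFDerivAt_bilin_of_eq_zero (E := GeomData V × Jet V)
    (innerSL ℝ) hY hY (by simp) (by simp)
  have h2 := ((h1.const_add 1).log (by simp)).const_mul (-(1 / 2) : ℝ)
  rw [smul_zero, smul_zero] at h2
  exact h2.fderiv

theorem fderiv_lowerOrder (T : (V →L[ℝ] V) →L[ℝ] ℝ) (a : GeomData V) :
    fderiv ℝ (lowerOrder T) (a, 0) = 0 := by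
  have hR := contDiffOn_jetRes (V := V)
  have hY := contDiffOn_jetRes_slope (V := V)
  have hZ := hR.clm_apply hY
  have hA : ContDiffOn ℝ ∞ (fun x : GeomData V × Jet V => GeomData.shape x.1) (regularSet V) := by
    fun_prop
  have hx : ContDiffOn ℝ ∞ (fun x : GeomData V × Jet V => GeomData.pos x.1) (regularSet V) := by
    fun_prop
  have hD :
      ContDiffOn ℝ ∞ (fun x : GeomData V × Jet V => (GeomData.dshape x.1).flip) (regularSet V) :=
    contDiff_flip.comp_contDiffOn
      (by fun_prop :
          ContDiffOn ℝ ∞ (fun x : GeomData V × Jet V => GeomData.dshape x.1) (regularSet V))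
  have hT := T.contDiff (n := ∞)
  have h1 := differentiableAt_of_contDiffOn_regularSet
    (((contDiffOn_const (c := (1 / 2 : ℝ))).mul (hx.inner ℝ (hA.clm_apply hY))).add
    ((hT.comp_contDiffOn (hA.clm_comp (hR.clm_comp hA))).sub
      (hT.comp_contDiffOn (hA.clm_comp hA))) |>.add
    (hT.comp_contDiffOn (hR.clm_comp (hD.clm_apply hZ)))) a
  have h2 := differentiableAt_of_contDiffOn_regularSet (hR.clm_apply (hA.clm_apply hZ)) a
  -- The factor multiplying u vanishes at the zero jet: Y and Z are zero there, and R = 1 makes the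
  -- two traces cancel.
  have h3 := hasFDerivAt_bilin_of_eq_zero (E := GeomData V × Jet V) (ContinuousLinearMap.lsmul ℝ ℝ)
    (f := fun x : GeomData V × Jet V => Jet.val x.2) (by fun_prop) h1 rfl
    (by simp [jetRes_zero, ContinuousLinearMap.one_def])
  have h4 := hasFDerivAt_bilin_of_eq_zero (E := GeomData V × Jet V) (innerSL ℝ)
    (f := fun x : GeomData V × Jet V => Jet.grad x.2) (by fun_prop) h2 rfl (by simp)
  have h5 := h3.add h4
  rw [add_zero] at h5
  exact h5.fderiv

/-- `F` is smooth where `1 + sA` is invertible and vanishes to second order at the zero jet, up to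
a function of the geometric data that is locally constant. -/
structure IsSecondOrder {G : Type*} [NormedAddCommGroup G] [NormedSpace ℝ G]
    (F : GeomData V × Jet V → G) : Prop where
  contDiffOn : ContDiffOn ℝ ∞ F (regularSet V)
  fderiv_eq_zero : ∀ a, fderiv ℝ F (a, 0) = 0

theorem isSecondOrder_fluxErr : IsSecondOrder (fluxErr (V := V)) :=
  ⟨contDiffOn_fluxErr, fderiv_fluxErr⟩

theorem isSecondOrder_logSpeed : IsSecondOrder (logSpeed (V := V)) :=
  ⟨contDiffOn_logSpeed, fderiv_logSpeed⟩

theorem isSecondOrder_lowerOrder (T : (V →L[ℝ] V) →L[ℝ] ℝ) : IsSecondOrder (lowerOrder T) :=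
  ⟨contDiffOn_lowerOrder T, fderiv_lowerOrder T⟩

theorem IsSecondOrder.exists_bounds {G : Type*} [NormedAddCommGroup G] [NormedSpace ℝ G]
    {F : GeomData V × Jet V → G} (hF : IsSecondOrder F) {S : Set (Amb n)} {N : Amb n → Amb n}
    (hS : IsClosedHypersurface S) (hN : IsUnitNormal S N) {α : Amb n → GeomData V}
    (hα : ContDiffOn ℝ ∞ α S) :
    ∃ C ε : ℝ, 0 ≤ C ∧ 0 < ε ∧ ∀ z z' : Amb n → Jet V, ∀ p ∈ S, ‖z p‖ ≤ ε → ‖z' p‖ ≤ ε →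
      DifferentiableWithinAt ℝ z S p → DifferentiableWithinAt ℝ z' S p →
      (α p, z p) ∈ regularSet V ∧
      ‖F (α p, z p) - F (α p, z' p)‖ ≤ C * (‖z p‖ + ‖z' p‖) * ‖z p - z' p‖ ∧
      ‖tanDeriv S N (fun x => F (α x, z x)) p - tanDeriv S N (fun x => F (α x, z' x)) p‖ ≤
        C * (‖z p‖ + ‖z' p‖) * ‖z p - z' p‖ + C * ‖z p - z' p‖ * ‖tanDeriv S N z p‖ +
          C * ‖z' p‖ * ‖tanDeriv S N z p - tanDeriv S N z' p‖ :=
  exists_second_order_bounds (E := GeomData V) (Z := Jet V) (F := F) (Ω := regularSet V)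
    (α := α) hS hN isOpen_regularSet hF.contDiffOn zero_mem_regularSet
    hF.fderiv_eq_zero hα

end SecondOrder

/-! ### The nonlinearity in divergence form -/

section Formula
variable {S : Set (Amb n)} {N : Amb n → Amb n} {u : Amb n → ℝ}

/-- The geometric data along a hypersurface. -/
def geomData (S : Set (Amb n)) (N : Amb n → Amb n) (p : Amb n) : GeomData (Amb n) :=
  (p, tanDeriv S N N p, tanDeriv S N (tanDeriv S N N) p)

/-- The jet of a function on a hypersurface. -/
def jet (S : Set (Amb n)) (N : Amb n → Amb n) (u : Amb n → ℝ) (p : Amb n) : Jet (Amb n) :=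
  (u p, tanGrad S N u p)

/-- The flux `(1 + uA)⁻² ∇u`. -/
def graphFlux (S : Set (Amb n)) (N : Amb n → Amb n) (u : Amb n → ℝ) (p : Amb n) : Amb n :=
  graphRes S N u p (graphSlope S N u p)

theorem contDiffOn_shape (hS : IsClosedHypersurface S) (hN : IsUnitNormal S N) :
    ContDiffOn ℝ ∞ (tanDeriv S N N) S :=
  contDiffOn_tanDeriv hS hN le_rfl le_rfl hN.contDiffOn

theorem contDiffOn_geomData (hS : IsClosedHypersurface S) (hN : IsUnitNormal S N) :
    ContDiffOn ℝ ∞ (geomData S N) S :=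
  contDiffOn_id.prodMk ((contDiffOn_shape hS hN).prodMk
    (contDiffOn_tanDeriv hS hN le_rfl le_rfl (contDiffOn_shape hS hN)))

theorem contDiffOn_jet (hS : IsClosedHypersurface S) (hN : IsUnitNormal S N) {k : ℕ∞}
    (hu : ContDiffOn ℝ (k + 1) u S) : ContDiffOn ℝ k (jet S N u) S :=
  (hu.of_le le_self_add).prodMk
    (contDiffOn_tanGrad hS hN le_rfl (WithTop.coe_le_coe.2 le_top) hu)

/-- The geometric data are smooth, so the only loss is the derivative spent on the gradient in the
jet. -/
theorem contDiffOn_comp_jet {G : Type*} [NormedAddCommGroup G] [NormedSpace ℝ G]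
    (hS : IsClosedHypersurface S) (hN : IsUnitNormal S N) {F : GeomData (Amb n) × Jet (Amb n) → G}
    (hF : ContDiffOn ℝ ∞ F (regularSet (Amb n))) {k : ℕ∞} (hu : ContDiffOn ℝ (k + 1) u S)
    (hreg : ∀ p ∈ S, IsUnit (1 + u p • tanDeriv S N N p)) :
    ContDiffOn ℝ k (fun p => F (geomData S N p, jet S N u p)) S :=
  (hF.of_le (WithTop.coe_le_coe.2 le_top)).comp
    (((contDiffOn_geomData hS hN).of_le (WithTop.coe_le_coe.2 le_top)).prodMk
      (contDiffOn_jet hS hN hu)) (fun p hp => hreg p hp)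

variable {p : Amb n}

/-- The mean curvature of a graph in non-divergence form. -/
theorem speed_mul_graphMeanCurv (hS : IsClosedHypersurface S) (hN : IsUnitNormal S N)
    (hu : ContDiffOn ℝ ((1 : ℕ∞) + 1) u S)
    (hreg : ∀ p ∈ S, IsUnit (1 + u p • tanDeriv S N N p)) (hp : p ∈ S) :
    graphSpeed S N u p * graphMeanCurv S N u p =
      opTrace n (graphRes S N u p * tanDeriv S N N p) -
        opTrace n (graphRes S N u p * tanDeriv S N (graphSlope S N u) p) +
        (graphSpeed S N u p ^ 2)⁻¹ *
          ⟪graphSlope S N u p, tanDeriv S N (graphSlope S N u) p (graphFlux S N u p)⟫_ℝ := by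
  have hud : ∀ x ∈ S, DifferentiableWithinAt ℝ u S x := hu.differentiableOn (by simp)
  have hYs : ContDiffOn ℝ (1 : ℕ∞) (graphSlope S N u) S :=
    contDiffOn_comp_jet hS hN contDiffOn_jetRes_slope hu hreg
  have hYd : DifferentiableWithinAt ℝ (graphSlope S N u) S p :=
    hYs.differentiableOn (by simp) p hp
  have hwd : DifferentiableWithinAt ℝ (fun x => (graphSpeed S N u x)⁻¹) S p := by
    refine DifferentiableWithinAt.inv ?_ (graphSpeed_pos p).ne'
    exact ((hYd.inner ℝ hYd).const_add 1).sqrt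
      (add_pos_of_pos_of_nonneg one_pos real_inner_self_nonneg).ne'
  refine trace_graph (hreg p hp) (tanDeriv_normal_symm hS hN hp) (hN.inner_self hp)
    (hN.tanDeriv_normal hp N) (hN.inner_tanGrad_normal hp u) rfl (hN.tanDeriv_normal hp _)
    (inner_normal_tanDeriv hS hN hp hYd
      (fun x hx => inner_normal_graphSlope hS hN hx (hreg x hx)))
    (graphSpeed_pos p) (graphSpeed_sq p) (graphNormal_eq hS hN hp (hud p hp) (hreg p hp))
    (hN.tanDeriv_normal hp (fun x => (graphSpeed S N u x)⁻¹)) ?_ ?_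
  · intro e
    rw [graphFrame, add_apply, tanDeriv_graphMap hS hN hp (hud p hp)]
    simp
  · intro e
    rw [tanDeriv_congr hp (fun x hx => graphNormal_eq hS hN hx (hud x hx) (hreg x hx)),
      tanDeriv_smul_apply hS hN hp hwd ((hN.differentiableWithinAt hp).fun_sub hYd),
      tanDeriv_sub hS hN hp (hN.differentiableWithinAt hp) hYd]
    rfl

/-- From n_u = w⁻¹(N - Y) one gets ⟨N, n_u⟩ = w⁻¹, so the speed factor is w, and w η_u = ⟨p + uN, N
- Y⟩. -/
theorem rmcfOp_eq (hS : IsClosedHypersurface S) (hN : IsUnitNormal S N)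
    (hu : ContDiffOn ℝ ((1 : ℕ∞) + 1) u S)
    (hreg : ∀ p ∈ S, IsUnit (1 + u p • tanDeriv S N N p)) (hp : p ∈ S) :
    rmcfOp S N u p = (⟪p, N p⟫_ℝ + u p - ⟪p, graphSlope S N u p⟫_ℝ) / 2 -
      (opTrace n (graphRes S N u p * tanDeriv S N N p) -
        opTrace n (graphRes S N u p * tanDeriv S N (graphSlope S N u) p) +
        (graphSpeed S N u p ^ 2)⁻¹ *
          ⟪graphSlope S N u p, tanDeriv S N (graphSlope S N u) p (graphFlux S N u p)⟫_ℝ) := by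
  have hud : DifferentiableWithinAt ℝ u S p := hu.differentiableOn (by simp) p hp
  have hw0 := (graphSpeed_pos (S := S) (N := N) (u := u) p).ne'
  have hNY := inner_normal_graphSlope hS hN hp (hreg p hp)
  have hn := graphNormal_eq hS hN hp hud (hreg p hp)
  have hs : speedFn S N u p = graphSpeed S N u p := by
    rw [speedFn, hn, inner_smul_right, inner_sub_right, hN.inner_self hp, hNY]
    simp
  have hη : graphSpeed S N u p * supportFn S N u p =
      ⟪p, N p⟫_ℝ + u p - ⟪p, graphSlope S N u p⟫_ℝ := by
    rw [supportFn, hn, graphMap, inner_smul_right, inner_sub_right, inner_add_left, inner_add_left,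
      inner_smul_left, inner_smul_left, hN.inner_self hp, hNY]
    field_simp
    simp
  rw [rmcfOp, hs, mul_sub, speed_mul_graphMeanCurv hS hN hu hreg hp, ← hη]
  ring

/-- The product rule for Z = RY. After taking traces, it replaces tr(R DY) by div Z plus terms that
depend only on the 1-jet of u. -/
theorem tanDeriv_graphFlux (hS : IsClosedHypersurface S) (hN : IsUnitNormal S N)
    (hu : ContDiffOn ℝ ((1 : ℕ∞) + 1) u S)
    (hreg : ∀ p ∈ S, IsUnit (1 + u p • tanDeriv S N N p)) (hp : p ∈ S) :
    tanDeriv S N (graphFlux S N u) p =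
      graphRes S N u p * tanDeriv S N (graphSlope S N u) p -
      (innerSL ℝ (tanGrad S N u p)).smulRight
        (graphRes S N u p (tanDeriv S N N p (graphFlux S N u p))) -
      u p • (graphRes S N u p * (tanDeriv S N (tanDeriv S N N) p).flip (graphFlux S N u p)) := by
  have hud : DifferentiableWithinAt ℝ u S p := hu.differentiableOn (by simp) p hp
  have hYd : DifferentiableWithinAt ℝ (graphSlope S N u) S p :=
    (contDiffOn_comp_jet hS hN contDiffOn_jetRes_slope hu hreg).differentiableOn (by simp) p hp
  have hRd : DifferentiableWithinAt ℝ (graphRes S N u) S p :=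
    (contDiffOn_comp_jet hS hN contDiffOn_jetRes hu hreg).differentiableOn (by simp) p hp
  ext1 e
  have h := tanDeriv_bilin_apply hS hN (ContinuousLinearMap.id ℝ (Amb n →L[ℝ] Amb n)) hp hRd hYd e
  have h' : tanDeriv S N (graphFlux S N u) p e = _ := h
  rw [h', tanDeriv_graphRes_apply hS hN hp hud (hreg p hp)]
  show -(graphRes S N u p (⟪tanGrad S N u p, e⟫_ℝ • tanDeriv S N N p (graphFlux S N u p) +
      u p • tanDeriv S N (tanDeriv S N N) p e (graphFlux S N u p))) +
      graphRes S N u p (tanDeriv S N (graphSlope S N u) p e) =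
    graphRes S N u p (tanDeriv S N (graphSlope S N u) p e) -
      ⟪tanGrad S N u p, e⟫_ℝ • graphRes S N u p (tanDeriv S N N p (graphFlux S N u p)) -
      u p • graphRes S N u p (tanDeriv S N (tanDeriv S N N) p e (graphFlux S N u p))
  rw [map_add, map_smul, map_smul]
  abel

/-- Evaluated on Z, this recognizes the remaining second order term of the mean curvature as a
pairing with a gradient. -/
theorem tanDeriv_logSpeed (hS : IsClosedHypersurface S) (hN : IsUnitNormal S N)
    (hu : ContDiffOn ℝ ((1 : ℕ∞) + 1) u S)
    (hreg : ∀ p ∈ S, IsUnit (1 + u p • tanDeriv S N N p)) (hp : p ∈ S) (e : Amb n) :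
    tanDeriv S N (fun x => logSpeed (geomData S N x, jet S N u x)) p e =
      -((graphSpeed S N u p ^ 2)⁻¹ *
        ⟪graphSlope S N u p, tanDeriv S N (graphSlope S N u) p e⟫_ℝ) := by
  have hYd : DifferentiableWithinAt ℝ (graphSlope S N u) S p :=
    (contDiffOn_comp_jet hS hN contDiffOn_jetRes_slope hu hreg).differentiableOn (by simp) p hp
  have hpos : (1 + ⟪graphSlope S N u p, graphSlope S N u p⟫_ℝ) ≠ 0 :=
    (add_pos_of_pos_of_nonneg one_pos real_inner_self_nonneg).ne'
  have hlog : HasFDerivAt (fun t : ℝ => -(1 / 2) * Real.log (1 + t)) _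
      ⟪graphSlope S N u p, graphSlope S N u p⟫_ℝ :=
    ((((hasDerivAt_id _).const_add 1).log hpos).const_mul (-(1 / 2) : ℝ)).hasFDerivAt
  have h : tanDeriv S N (fun x => logSpeed (geomData S N x, jet S N u x)) p = _ :=
    tanDeriv_comp hS hN hp (X := fun x => ⟪graphSlope S N u x, graphSlope S N u x⟫_ℝ)
      (hYd.inner ℝ hYd) hlog
  rw [h, ContinuousLinearMap.comp_apply, tanDeriv_inner_apply hS hN hp hYd hYd, graphSpeed_sq,
    real_inner_comm (graphSlope S N u p) (tanDeriv S N (graphSlope S N u) p e)]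
  simp
  ring

/-- The nonlinearity in divergence form. -/
theorem nonlinQ_eq (hS : IsClosedHypersurface S) (hN : IsUnitNormal S N)
    (hu : ContDiffOn ℝ ((1 : ℕ∞) + 1) u S)
    (hreg : ∀ p ∈ S, IsUnit (1 + u p • tanDeriv S N N p)) (hp : p ∈ S) :
    nonlinQ S N u p = ⟪p, N p⟫_ℝ / 2 - meanCurv S N p +
      lowerOrder (opTrace n) (geomData S N p, jet S N u p) +
      tanDiv S N (fun x => fluxErr (geomData S N x, jet S N u x)) p +
      ⟪tanGrad S N (fun x => logSpeed (geomData S N x, jet S N u x)) p, graphFlux S N u p⟫_ℝ := by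
  have hGd : DifferentiableWithinAt ℝ (tanGrad S N u) S p :=
    (contDiffOn_tanGrad hS hN le_rfl (WithTop.coe_le_coe.2 le_top) hu).differentiableOn
      (by simp) p hp
  have hYd : DifferentiableWithinAt ℝ (graphSlope S N u) S p :=
    (contDiffOn_comp_jet hS hN contDiffOn_jetRes_slope hu hreg).differentiableOn (by simp) p hp
  have hRd : DifferentiableWithinAt ℝ (graphRes S N u) S p :=
    (contDiffOn_comp_jet hS hN contDiffOn_jetRes hu hreg).differentiableOn (by simp) p hp
  have hflux : tanDeriv S N (fun x => fluxErr (geomData S N x, jet S N u x)) p =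
      tanDeriv S N (graphFlux S N u) p - tanDeriv S N (tanGrad S N u) p :=
    tanDeriv_sub hS hN hp (hRd.clm_apply hYd) hGd
  have hY := mul_resolventOp (hreg p hp) (tanGrad S N u p)
  have hlin : ⟪p, tanGrad S N u p⟫_ℝ = ⟪p, graphSlope S N u p⟫_ℝ +
      u p * ⟪p, tanDeriv S N N p (graphSlope S N u p)⟫_ℝ := by
    conv_lhs => rw [← hY]
    rw [inner_add_right, inner_smul_right]; rfl
  -- From A = RA + uARA, the difference H - tr(RA) is u tr(ARA); subtracting the linear term u|A|² =
  -- u tr(A²) leaves a quadratic error.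
  have hH : meanCurv S N p = opTrace n (graphRes S N u p * tanDeriv S N N p) +
      u p * opTrace n (tanDeriv S N N p * (graphRes S N u p * tanDeriv S N N p)) := by
    rw [← smul_eq_mul (u p), ← map_smul, ← map_add]
    show opTrace n (tanDeriv S N N p) = _
    congr 1
    ext1 e
    exact (mul_resolventOp (hreg p hp) (tanDeriv S N N p e)).symm
  have hlow : lowerOrder (opTrace n) (geomData S N p, jet S N u p) =
      u p * (1 / 2 * ⟪p, tanDeriv S N N p (graphSlope S N u p)⟫_ℝ +
        (opTrace n (tanDeriv S N N p * (graphRes S N u p * tanDeriv S N N p)) -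
          opTrace n (tanDeriv S N N p * tanDeriv S N N p)) +
        opTrace n (graphRes S N u p *
          (tanDeriv S N (tanDeriv S N N) p).flip (graphFlux S N u p))) +
      ⟪tanGrad S N u p, graphRes S N u p (tanDeriv S N N p (graphFlux S N u p))⟫_ℝ := rfl
  rw [nonlinQ, rmcfOp_eq hS hN hu hreg hp, secondVarOp, tanLaplacian, tanDiv, tanDiv,
    ← opTrace_apply, ← opTrace_apply, hflux, map_sub, tanDeriv_graphFlux hS hN hu hreg hp, map_sub,
    map_sub, map_smul, opTrace_smulRight, inner_tanGrad, tanDeriv_logSpeed hS hN hu hreg hp, hlow,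
    secondFundSq, ← opTrace_mul_self (tanDeriv_normal_symm hS hN hp), hH, hlin, innerSL_apply_apply,
    smul_eq_mul]
  ring

end Formula

/-! ### Norm comparisons and estimates in terms of u, ∇u and the Hessian -/

section Norms

theorem hsNorm_nonneg (T : Amb n →L[ℝ] Amb n) : 0 ≤ hsNorm T := Real.sqrt_nonneg _

theorem norm_apply_le_hsNorm (T : Amb n →L[ℝ] Amb n) (v : Amb n) : ‖T v‖ ≤ hsNorm T * ‖v‖ := by
  have hv : T v = ∑ i, v i • T (EuclideanSpace.basisFun (Fin (n + 1)) ℝ i) := by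
    conv_lhs => rw [← (EuclideanSpace.basisFun (Fin (n + 1)) ℝ).sum_repr v]
    simp [map_sum]
  rw [hv, hsNorm, EuclideanSpace.norm_eq v]
  calc _ ≤ ∑ i, ‖v i • T (EuclideanSpace.basisFun (Fin (n + 1)) ℝ i)‖ := norm_sum_le _ _
    _ = ∑ i, ‖T (EuclideanSpace.basisFun (Fin (n + 1)) ℝ i)‖ * ‖v i‖ := by
      refine Finset.sum_congr rfl fun i _ => ?_
      rw [norm_smul, mul_comm]
    _ ≤ _ := Real.sum_mul_le_sqrt_mul_sqrt _ _ _

theorem continuous_hsNorm : Continuous (hsNorm (n := n)) := by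
  unfold hsNorm
  refine Real.continuous_sqrt.comp (continuous_finsetSum _ fun i _ => ?_)
  exact (((ContinuousLinearMap.apply ℝ (Amb n)
    (EuclideanSpace.basisFun (Fin (n + 1)) ℝ i)).continuous).norm).pow 2

theorem abs_opTrace_le (T : Amb n →L[ℝ] Amb n) : |opTrace n T| ≤ (n + 1) * ‖T‖ := by
  rw [opTrace_apply, LinearMap.trace_eq_sum_inner _ (EuclideanSpace.basisFun (Fin (n + 1)) ℝ)]
  refine (Finset.abs_sum_le_sum_abs _ _).trans ?_
  refine (Finset.sum_le_card_nsmul _ _ ‖T‖ fun i _ => ?_).trans (by simp)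
  refine (abs_real_inner_le_norm _ _).trans ?_
  have h := T.le_opNorm (EuclideanSpace.basisFun (Fin (n + 1)) ℝ i)
  have h1 : ‖EuclideanSpace.basisFun (Fin (n + 1)) ℝ i‖ = 1 :=
    (EuclideanSpace.basisFun (Fin (n + 1)) ℝ).orthonormal.1 i
  rw [h1, mul_one] at h
  rw [h1, one_mul]
  exact h

variable {S : Set (Amb n)} {N : Amb n → Amb n} {u v : Amb n → ℝ} {p : Amb n}

theorem norm_tanGrad : ‖tanGrad S N u p‖ = ‖tanDeriv S N u p‖ :=
  (InnerProductSpace.toDual ℝ (Amb n)).symm.norm_map _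

theorem tanGrad_sub (hS : IsClosedHypersurface S) (hN : IsUnitNormal S N) (hp : p ∈ S)
    (hu : DifferentiableWithinAt ℝ u S p) (hv : DifferentiableWithinAt ℝ v S p) :
    tanGrad S N (fun x => u x - v x) p = tanGrad S N u p - tanGrad S N v p := by
  rw [tanGrad, tanDeriv_sub hS hN hp hu hv, map_sub]; rfl

theorem tanGrad_add (hS : IsClosedHypersurface S) (hN : IsUnitNormal S N) (hp : p ∈ S)
    (hu : DifferentiableWithinAt ℝ u S p) (hv : DifferentiableWithinAt ℝ v S p) :
    tanGrad S N (fun x => u x + v x) p = tanGrad S N u p + tanGrad S N v p := by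
  rw [tanGrad, tanDeriv_add hS hN hp hu hv, map_add]; rfl

theorem tanGrad_zero (hS : IsClosedHypersurface S) (hN : IsUnitNormal S N) (hp : p ∈ S) :
    tanGrad S N (fun _ => 0) p = 0 := by
  rw [tanGrad, tanDeriv_const hS hN hp, map_zero]

theorem tanHess_zero (hS : IsClosedHypersurface S) (hN : IsUnitNormal S N) (hp : p ∈ S) :
    tanHess S N (fun _ => 0) p = 0 := by
  rw [tanHess, tanDeriv_congr (X₁ := fun _ => (0 : Amb n)) hp (fun x hx => tanGrad_zero hS hN hx),
    tanDeriv_const hS hN hp, ContinuousLinearMap.comp_zero]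

theorem differentiableWithinAt_tanGrad (hS : IsClosedHypersurface S) (hN : IsUnitNormal S N)
    (hp : p ∈ S) (hu : ContDiffOn ℝ ((1 : ℕ∞) + 1) u S) :
    DifferentiableWithinAt ℝ (tanGrad S N u) S p :=
  (contDiffOn_tanGrad hS hN le_rfl (WithTop.coe_le_coe.2 le_top) hu).differentiableOn
    (by simp) p hp

/-- The Hessian is only the tangential part of D∇u. Since ∇u is tangent, the normal part is fixed by
the shape operator and is of first order in u, so D∇u is controlled by the Hessian and the gradient.
-/
theorem tanDeriv_tanGrad_apply (hS : IsClosedHypersurface S) (hN : IsUnitNormal S N)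
    (hp : p ∈ S) (hu : ContDiffOn ℝ ((1 : ℕ∞) + 1) u S) (e : Amb n) :
    tanDeriv S N (tanGrad S N u) p e =
      tanHess S N u p e - ⟪tanDeriv S N N p e, tanGrad S N u p⟫_ℝ • N p := by
  have h := inner_normal_tanDeriv hS hN hp (differentiableWithinAt_tanGrad hS hN hp hu)
    (fun x hx => hN.inner_tanGrad_normal hx u) e
  rw [tanHess, ContinuousLinearMap.comp_apply, tanProj_apply, h]
  module

theorem norm_tanDeriv_tanGrad_le (hS : IsClosedHypersurface S) (hN : IsUnitNormal S N)
    (hp : p ∈ S) (hu : ContDiffOn ℝ ((1 : ℕ∞) + 1) u S) :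
    ‖tanDeriv S N (tanGrad S N u) p‖ ≤
      hsNorm (tanHess S N u p) + ‖tanDeriv S N N p‖ * ‖tanGrad S N u p‖ := by
  refine ContinuousLinearMap.opNorm_le_bound _
    (add_nonneg (hsNorm_nonneg _) (by positivity)) fun e => ?_
  rw [tanDeriv_tanGrad_apply hS hN hp hu]
  refine (norm_sub_le _ _).trans ?_
  rw [norm_smul, hN.norm_eq_one p hp, mul_one, add_mul]
  refine add_le_add (norm_apply_le_hsNorm _ _) ?_
  refine (norm_inner_le_norm _ _).trans ?_
  calc _ ≤ ‖tanDeriv S N N p‖ * ‖e‖ * ‖tanGrad S N u p‖ := by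
        gcongr; exact ContinuousLinearMap.le_opNorm _ _
    _ = _ := by ring

theorem norm_tanDeriv_tanGrad_sub_le (hS : IsClosedHypersurface S) (hN : IsUnitNormal S N)
    (hp : p ∈ S) (hu : ContDiffOn ℝ ((1 : ℕ∞) + 1) u S) (hv : ContDiffOn ℝ ((1 : ℕ∞) + 1) v S) :
    ‖tanDeriv S N (tanGrad S N u) p - tanDeriv S N (tanGrad S N v) p‖ ≤
      hsNorm (tanHess S N u p - tanHess S N v p) +
        ‖tanDeriv S N N p‖ * ‖tanGrad S N u p - tanGrad S N v p‖ := by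
  refine ContinuousLinearMap.opNorm_le_bound _
    (add_nonneg (hsNorm_nonneg _) (by positivity)) fun e => ?_
  have h : (tanDeriv S N (tanGrad S N u) p - tanDeriv S N (tanGrad S N v) p) e =
      (tanHess S N u p - tanHess S N v p) e -
        ⟪tanDeriv S N N p e, tanGrad S N u p - tanGrad S N v p⟫_ℝ • N p := by
    rw [sub_apply, sub_apply, tanDeriv_tanGrad_apply hS hN hp hu,
      tanDeriv_tanGrad_apply hS hN hp hv, inner_sub_right]
    module
  rw [h]
  refine (norm_sub_le _ _).trans ?_
  rw [norm_smul, hN.norm_eq_one p hp, mul_one, add_mul]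
  refine add_le_add (norm_apply_le_hsNorm _ _) ?_
  refine (norm_inner_le_norm _ _).trans ?_
  calc _ ≤ ‖tanDeriv S N N p‖ * ‖e‖ * ‖tanGrad S N u p - tanGrad S N v p‖ := by
        gcongr; exact ContinuousLinearMap.le_opNorm _ _
    _ = _ := by ring

theorem le_iSup_of_continuousOn (hS : IsCompact S) {φ : Amb n → ℝ} (hφ : ContinuousOn φ S)
    (hp : p ∈ S) : φ p ≤ ⨆ q : S, φ q := by
  refine le_ciSup (f := fun q : S => φ q) ?_ ⟨p, hp⟩
  have := hS.bddAbove_image hφ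
  rwa [image_eq_range] at this

theorem le_c1Norm (hS : IsClosedHypersurface S) (hN : IsUnitNormal S N) (hp : p ∈ S)
    (hu : ContDiffOn ℝ ((1 : ℕ∞) + 1) u S) :
    |u p| + ‖tanGrad S N u p‖ ≤ c1Norm S N u :=
  le_iSup_of_continuousOn (φ := fun p => |u p| + ‖tanGrad S N u p‖) hS.isCompact
    (hu.continuousOn.abs.add (contDiffOn_tanGrad hS hN le_rfl
      (WithTop.coe_le_coe.2 le_top) hu).continuousOn.norm) hp

theorem le_c2Norm (hS : IsClosedHypersurface S) (hN : IsUnitNormal S N) (hp : p ∈ S)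
    (hu : ContDiffOn ℝ ((1 : ℕ∞) + 1) u S) :
    |u p| + ‖tanGrad S N u p‖ + hsNorm (tanHess S N u p) ≤ c2Norm S N u := by
  have hG := contDiffOn_tanGrad hS hN le_rfl (WithTop.coe_le_coe.2 le_top) hu
  have hH : ContinuousOn (tanHess S N u) S :=
    (contDiffOn_tanProj hN).continuousOn.clm_comp
      (contDiffOn_tanDeriv hS hN (m := 0) (k := (1 : ℕ∞)) (by simp) (by simp) hG).continuousOn
  exact le_iSup_of_continuousOn
    (φ := fun p => |u p| + ‖tanGrad S N u p‖ + hsNorm (tanHess S N u p)) hS.isCompact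
    ((hu.continuousOn.abs.add hG.continuousOn.norm).add
      (continuous_hsNorm.comp_continuousOn hH)) hp

/-- Uniform estimates for a function of the jet that vanishes to second order at the zero jet. -/
theorem exists_jet_bounds {G : Type*} [NormedAddCommGroup G] [NormedSpace ℝ G]
    (hS : IsClosedHypersurface S) (hN : IsUnitNormal S N)
    {F : GeomData (Amb n) × Jet (Amb n) → G} (hF : IsSecondOrder F) :
    ∃ C ε : ℝ, 0 ≤ C ∧ 0 < ε ∧ ∀ u v : Amb n → ℝ, ContDiffOn ℝ ((1 : ℕ∞) + 1) u S →
      ContDiffOn ℝ ((1 : ℕ∞) + 1) v S → ∀ p ∈ S, ∀ a b d D K : ℝ,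
      a = |u p| + ‖tanGrad S N u p‖ → b = |v p| + ‖tanGrad S N v p‖ →
      d = |u p - v p| + ‖tanGrad S N u p - tanGrad S N v p‖ →
      D = hsNorm (tanHess S N u p - tanHess S N v p) → K = hsNorm (tanHess S N u p) →
      a ≤ ε → b ≤ ε →
      IsUnit (1 + u p • tanDeriv S N N p) ∧
      ‖F (geomData S N p, jet S N u p) - F (geomData S N p, jet S N v p)‖ ≤ C * (a + b) * d ∧
      ‖tanDeriv S N (fun x => F (geomData S N x, jet S N u x)) p -
        tanDeriv S N (fun x => F (geomData S N x, jet S N v x)) p‖ ≤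
          C * (a + b) * d + C * K * d + C * b * D := by
  obtain ⟨C, ε, hC, hε, h⟩ := hF.exists_bounds hS hN (contDiffOn_geomData hS hN)
  obtain ⟨M, hM⟩ := hS.isCompact.exists_bound_of_continuousOn (contDiffOn_shape hS hN).continuousOn
  -- M bounds the shape operator. The factor 2 is needed because the normal parts of D∇u and D∇u -
  -- D∇v contribute additional multiples of (a + b)d.
  refine ⟨2 * C * (1 + |M|), ε, by positivity, hε, ?_⟩
  intro u v hu hv p hp a b d D K ha hb hd hDD hK haε hbε
  have hjet : ∀ w : Amb n → ℝ, ‖jet S N w p‖ ≤ |w p| + ‖tanGrad S N w p‖ := fun w =>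
    max_le (le_add_of_nonneg_right (norm_nonneg _)) (le_add_of_nonneg_left (abs_nonneg _))
  have hjd : ‖jet S N u p - jet S N v p‖ ≤ d := by
    rw [hd]
    exact max_le (le_add_of_nonneg_right (norm_nonneg _)) (le_add_of_nonneg_left (abs_nonneg _))
  have hju : ‖jet S N u p‖ ≤ a := ha ▸ hjet u
  have hjv : ‖jet S N v p‖ ≤ b := hb ▸ hjet v
  have hdiff : ∀ w : Amb n → ℝ, ContDiffOn ℝ ((1 : ℕ∞) + 1) w S →
      DifferentiableWithinAt ℝ (jet S N w) S p := fun w hw =>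
    (contDiffOn_jet hS hN hw).differentiableOn (by simp) p hp
  have hMp : ‖tanDeriv S N N p‖ ≤ |M| := (hM p hp).trans (le_abs_self M)
  have hDu : tanDeriv S N (jet S N u) p =
      (tanDeriv S N u p).prod (tanDeriv S N (tanGrad S N u) p) :=
    tanDeriv_prodMk hS hN hp (hu.differentiableOn (by simp) p hp)
      (differentiableWithinAt_tanGrad hS hN hp hu)
  have hDv : tanDeriv S N (jet S N v) p =
      (tanDeriv S N v p).prod (tanDeriv S N (tanGrad S N v) p) :=
    tanDeriv_prodMk hS hN hp (hv.differentiableOn (by simp) p hp)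
      (differentiableWithinAt_tanGrad hS hN hp hv)
  have hprod : ∀ (T : Amb n →L[ℝ] ℝ) (T' : Amb n →L[ℝ] Amb n), ‖T.prod T'‖ ≤ ‖T‖ + ‖T'‖ := by
    intro T T'
    rw [ContinuousLinearMap.opNorm_prod]
    exact max_le (le_add_of_nonneg_right (norm_nonneg _)) (le_add_of_nonneg_left (norm_nonneg _))
  have hK0 : 0 ≤ K := hK ▸ hsNorm_nonneg _
  have hD0 : 0 ≤ D := hDD ▸ hsNorm_nonneg _
  have ha0 : 0 ≤ a := (norm_nonneg _).trans hju
  have hb0 : 0 ≤ b := (norm_nonneg _).trans hjv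
  have hd0 : 0 ≤ d := (norm_nonneg _).trans hjd
  have h1 : ‖tanDeriv S N (jet S N u) p‖ ≤ (1 + |M|) * (a + K) := by
    have hga : ‖tanGrad S N u p‖ ≤ a := by rw [ha]; exact le_add_of_nonneg_left (abs_nonneg _)
    have hH := norm_tanDeriv_tanGrad_le hS hN hp hu
    rw [← hK] at hH
    rw [hDu]
    refine (hprod _ _).trans ?_
    rw [← norm_tanGrad]
    have : ‖tanDeriv S N N p‖ * ‖tanGrad S N u p‖ ≤ |M| * a := by gcongr
    nlinarith [mul_nonneg (abs_nonneg M) hK0]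
  have h2 : ‖tanDeriv S N (jet S N u) p - tanDeriv S N (jet S N v) p‖ ≤ (1 + |M|) * (d + D) := by
    have hgd : ‖tanGrad S N u p - tanGrad S N v p‖ ≤ d := by
      rw [hd]; exact le_add_of_nonneg_left (abs_nonneg _)
    have hH := norm_tanDeriv_tanGrad_sub_le hS hN hp hu hv
    rw [← hDD] at hH
    have hsub : tanDeriv S N (jet S N u) p - tanDeriv S N (jet S N v) p =
        (tanDeriv S N u p - tanDeriv S N v p).prod
          (tanDeriv S N (tanGrad S N u) p - tanDeriv S N (tanGrad S N v) p) := by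
      rw [hDu, hDv]; rfl
    rw [hsub]
    refine (hprod _ _).trans ?_
    have hg : ‖tanDeriv S N u p - tanDeriv S N v p‖ = ‖tanGrad S N u p - tanGrad S N v p‖ := by
      rw [tanGrad, tanGrad, ← map_sub, LinearIsometryEquiv.norm_map]
    rw [hg]
    have : ‖tanDeriv S N N p‖ * ‖tanGrad S N u p - tanGrad S N v p‖ ≤ |M| * d := by gcongr
    nlinarith [mul_nonneg (abs_nonneg M) hD0]
  obtain ⟨hm, e1, e2⟩ := h (jet S N u) (jet S N v) p hp (hju.trans haε) (hjv.trans hbε)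
    (hdiff u hu) (hdiff v hv)
  have hCM : C ≤ 2 * C * (1 + |M|) := by nlinarith [mul_nonneg hC (abs_nonneg M)]
  refine ⟨hm, e1.trans (by gcongr), e2.trans ?_⟩
  calc _ ≤ C * (a + b) * d + C * d * ((1 + |M|) * (a + K)) + C * b * ((1 + |M|) * (d + D)) := by
        gcongr
    _ ≤ C * (1 + |M|) * ((a + b) * d) + C * (1 + |M|) * ((a + b) * d) +
        C * (1 + |M|) * (K * d) + C * (1 + |M|) * (b * D) := by
        have : C * (a + b) * d ≤ C * (1 + |M|) * ((a + b) * d) := by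
          have : C * 1 * ((a + b) * d) ≤ C * (1 + |M|) * ((a + b) * d) := by
            gcongr; linarith [abs_nonneg M]
          linarith
        linarith
    _ ≤ _ := by
        have h3 : 0 ≤ C * (1 + |M|) * (K * d) := by positivity
        have h4 : 0 ≤ C * (1 + |M|) * (b * D) := by positivity
        linarith

end Norms

/-! ### The difference of two nonlinearities -/

section Main
variable {S : Set (Amb n)} {N : Amb n → Amb n} {u v : Amb n → ℝ} {p : Amb n}

theorem jet_zero (hS : IsClosedHypersurface S) (hN : IsUnitNormal S N) (hp : p ∈ S) :
    jet S N (fun _ => 0) p = 0 :=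
  Prod.ext rfl (tanGrad_zero hS hN hp)

/-- The estimates of `exists_jet_bounds`, with the special case of the comparison with the zero
function for an `F` that vanishes at the zero jet. -/
theorem exists_jet_bounds_of_zero {G : Type*} [NormedAddCommGroup G] [NormedSpace ℝ G]
    (hS : IsClosedHypersurface S) (hN : IsUnitNormal S N)
    {F : GeomData (Amb n) × Jet (Amb n) → G} (hF : IsSecondOrder F) (hF0 : ∀ a, F (a, 0) = 0) :
    ∃ C ε : ℝ, 0 ≤ C ∧ 0 < ε ∧ (∀ u v : Amb n → ℝ, ContDiffOn ℝ ((1 : ℕ∞) + 1) u S →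
      ContDiffOn ℝ ((1 : ℕ∞) + 1) v S → ∀ p ∈ S, ∀ a b d D K : ℝ,
      a = |u p| + ‖tanGrad S N u p‖ → b = |v p| + ‖tanGrad S N v p‖ →
      d = |u p - v p| + ‖tanGrad S N u p - tanGrad S N v p‖ →
      D = hsNorm (tanHess S N u p - tanHess S N v p) → K = hsNorm (tanHess S N u p) →
      a ≤ ε → b ≤ ε →
      ‖F (geomData S N p, jet S N u p) - F (geomData S N p, jet S N v p)‖ ≤ C * (a + b) * d ∧
      ‖tanDeriv S N (fun x => F (geomData S N x, jet S N u x)) p -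
        tanDeriv S N (fun x => F (geomData S N x, jet S N v x)) p‖ ≤
          C * (a + b) * d + C * K * d + C * b * D) ∧
      ∀ u : Amb n → ℝ, ContDiffOn ℝ ((1 : ℕ∞) + 1) u S → ∀ p ∈ S, ∀ a K : ℝ,
        a = |u p| + ‖tanGrad S N u p‖ → K = hsNorm (tanHess S N u p) → a ≤ ε →
        IsUnit (1 + u p • tanDeriv S N N p) ∧
        ‖F (geomData S N p, jet S N u p)‖ ≤ C * a * a ∧
        ‖tanDeriv S N (fun x => F (geomData S N x, jet S N u x)) p‖ ≤ C * a * a + C * K * a := by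
  obtain ⟨C, ε, hC, hε, h⟩ := exists_jet_bounds hS hN hF
  refine ⟨C, ε, hC, hε, fun u v hu hv p hp a b d D K ha hb hd hD hK haε hbε =>
    (h u v hu hv p hp a b d D K ha hb hd hD hK haε hbε).2, ?_⟩
  intro u hu p hp a K ha hK haε
  -- For v = 0 the quantities become b = 0, d = a and D = K.
  have h0 := h u (fun _ => 0) hu contDiffOn_const p hp a 0 a K K ha
    (by simp [tanGrad_zero hS hN hp]) (by simp [ha, tanGrad_zero hS hN hp])
    (by simp [hK, tanHess_zero hS hN hp]) hK haε hε.le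
  have e1 : tanDeriv S N (fun x => F (geomData S N x, jet S N (fun _ => 0) x)) p = 0 := by
    rw [tanDeriv_congr (X₁ := fun _ => (0 : G)) hp
      (fun x hx => by rw [jet_zero hS hN hx, hF0]), tanDeriv_const hS hN hp]
  rw [jet_zero hS hN hp, hF0, e1] at h0
  simpa using h0

/-- The nonlinear part of the flux along the hypersurface. -/
def fluxErrAt (S : Set (Amb n)) (N : Amb n → Amb n) (u : Amb n → ℝ) (p : Amb n) : Amb n :=
  fluxErr (geomData S N p, jet S N u p)

/-- Minus the logarithm of the graph speed along the hypersurface. -/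
def logSpeedAt (S : Set (Amb n)) (N : Amb n → Amb n) (u : Amb n → ℝ) (p : Amb n) : ℝ :=
  logSpeed (geomData S N p, jet S N u p)

/-- The lower order part of the nonlinearity along the hypersurface. -/
def lowerOrderAt (S : Set (Amb n)) (N : Amb n → Amb n) (u : Amb n → ℝ) (p : Amb n) : ℝ :=
  lowerOrder (opTrace n) (geomData S N p, jet S N u p)

/-- Splitting off the linear part ∇u lets the quadratic bounds on the error yield the linear bounds
on the flux and on differences of fluxes. -/
theorem graphFlux_eq : graphFlux S N u p = fluxErrAt S N u p + tanGrad S N u p :=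
  (sub_add_cancel (graphFlux S N u p) (tanGrad S N u p)).symm

theorem contDiffOn_graphFlux (hS : IsClosedHypersurface S) (hN : IsUnitNormal S N) {k : ℕ∞}
    (hu : ContDiffOn ℝ (k + 1) u S) (hreg : ∀ p ∈ S, IsUnit (1 + u p • tanDeriv S N N p)) :
    ContDiffOn ℝ k (graphFlux S N u) S :=
  contDiffOn_comp_jet hS hN (contDiffOn_jetRes.clm_apply contDiffOn_jetRes_slope) hu hreg

theorem inner_normal_graphFlux (hS : IsClosedHypersurface S) (hN : IsUnitNormal S N) (hp : p ∈ S)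
    (h : IsUnit (1 + u p • tanDeriv S N N p)) : ⟪N p, graphFlux S N u p⟫_ℝ = 0 := by
  rw [graphFlux, graphRes, ← resolventOp_symm h (tanDeriv_normal_symm hS hN hp),
    resolventOp_of_eq_zero h (hN.tanDeriv_normal hp N), inner_normal_graphSlope hS hN hp h]

theorem contDiffOn_meanCurv (hS : IsClosedHypersurface S) (hN : IsUnitNormal S N) :
    ContDiffOn ℝ ∞ (meanCurv S N) S :=
  (opTrace n).contDiff.comp_contDiffOn (contDiffOn_shape hS hN)

/-- The difference of the nonlinearities of two functions. -/
theorem nonlinQ_sub (hS : IsClosedHypersurface S) (hN : IsUnitNormal S N)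
    (hu : ContDiffOn ℝ ((1 : ℕ∞) + 1) u S) (hv : ContDiffOn ℝ ((1 : ℕ∞) + 1) v S)
    (hur : ∀ p ∈ S, IsUnit (1 + u p • tanDeriv S N N p))
    (hvr : ∀ p ∈ S, IsUnit (1 + v p • tanDeriv S N N p)) (hp : p ∈ S) :
    nonlinQ S N u p - nonlinQ S N v p =
      (lowerOrderAt S N u p - lowerOrderAt S N v p -
        ⟪tanGrad S N (fun x => meanCurv S N x * (u x - v x)) p, graphFlux S N v p⟫_ℝ) +
      tanDiv S N (fun x => fluxErrAt S N u x - fluxErrAt S N v x) p +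
      ⟪tanGrad S N (logSpeedAt S N u) p, graphFlux S N u p - graphFlux S N v p⟫_ℝ +
      ⟪tanGrad S N (fun x => (logSpeedAt S N u x - logSpeedAt S N v x) +
        meanCurv S N x * (u x - v x)) p, graphFlux S N v p⟫_ℝ := by
  have hd : ∀ w : Amb n → ℝ, ContDiffOn ℝ ((1 : ℕ∞) + 1) w S →
      (∀ p ∈ S, IsUnit (1 + w p • tanDeriv S N N p)) →
      DifferentiableWithinAt ℝ (fluxErrAt S N w) S p ∧
        DifferentiableWithinAt ℝ (logSpeedAt S N w) S p := fun w hw hwr =>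
    ⟨(contDiffOn_comp_jet hS hN contDiffOn_fluxErr hw hwr).differentiableOn (by simp) p hp,
      (contDiffOn_comp_jet hS hN contDiffOn_logSpeed hw hwr).differentiableOn (by simp) p hp⟩
  have hH : DifferentiableWithinAt ℝ (fun x => meanCurv S N x * (u x - v x)) S p :=
    ((contDiffOn_meanCurv hS hN).differentiableOn (by simp) p hp).mul
      ((hu.differentiableOn (by simp) p hp).fun_sub (hv.differentiableOn (by simp) p hp))
  obtain ⟨fu, gu⟩ := hd u hu hur
  obtain ⟨fv, gv⟩ := hd v hv hvr
  -- The gradient terms are regrouped as ⟨∇g_u, Z_u⟩ - ⟨∇g_v, Z_v⟩ = ⟨∇g_u, Z_u - Z_v⟩ + ⟨∇(g_u -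
  -- g_v), Z_v⟩, and the two occurrences of H(u - v) cancel.
  rw [tanGrad_add hS hN hp (gu.fun_sub gv) hH, tanGrad_sub hS hN hp gu gv, tanDiv,
    tanDeriv_sub hS hN hp fu fv, ← opTrace_apply, map_sub, nonlinQ_eq hS hN hu hur hp,
    nonlinQ_eq hS hN hv hvr hp, inner_add_left, inner_sub_left, inner_sub_right]
  simp only [tanDiv, ← opTrace_apply]
  unfold lowerOrderAt logSpeedAt fluxErrAt
  ring

/-- First order estimate of the gradient of `H (u - v)`. -/
theorem norm_tanGrad_meanCurv_mul_sub_le (hS : IsClosedHypersurface S) (hN : IsUnitNormal S N)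
    (hp : p ∈ S) (hu : DifferentiableWithinAt ℝ u S p) (hv : DifferentiableWithinAt ℝ v S p)
    {M : ℝ} (hM : |meanCurv S N p| ≤ M) (hM' : ‖tanDeriv S N (meanCurv S N) p‖ ≤ M) :
    ‖tanGrad S N (fun x => meanCurv S N x * (u x - v x)) p‖ ≤
      M * (|u p - v p| + ‖tanGrad S N u p - tanGrad S N v p‖) := by
  have hHd : DifferentiableWithinAt ℝ (meanCurv S N) S p :=
    (contDiffOn_meanCurv hS hN).differentiableOn (by simp) p hp
  have hsub : tanDeriv S N (fun x => u x - v x) p = tanDeriv S N u p - tanDeriv S N v p :=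
    tanDeriv_sub hS hN hp hu hv
  have hg : ‖tanDeriv S N u p - tanDeriv S N v p‖ = ‖tanGrad S N u p - tanGrad S N v p‖ := by
    rw [tanGrad, tanGrad, ← map_sub, LinearIsometryEquiv.norm_map]
  have hM0 : 0 ≤ M := (abs_nonneg _).trans hM
  rw [norm_tanGrad]
  refine ContinuousLinearMap.opNorm_le_bound _ (by positivity) fun e => ?_
  have h : tanDeriv S N (fun x => meanCurv S N x * (u x - v x)) p e = _ :=
    tanDeriv_smul_apply hS hN hp hHd (hu.fun_sub hv) e
  rw [h, hsub]
  refine (norm_add_le _ _).trans ?_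
  rw [norm_smul, norm_smul, mul_add, add_mul]
  have e1 := (tanDeriv S N (meanCurv S N) p).le_opNorm e
  have e2 := (tanDeriv S N u p - tanDeriv S N v p).le_opNorm e
  rw [hg] at e2
  refine add_le_add ?_ ?_
  · calc _ ≤ (M * ‖e‖) * |u p - v p| := by
          rw [Real.norm_eq_abs (u p - v p)]
          gcongr
          exact e1.trans (by gcongr)
      _ = _ := by ring
  · calc _ ≤ M * (‖tanGrad S N u p - tanGrad S N v p‖ * ‖e‖) := by
          gcongr
          exact hM
      _ = _ := by ring

end Main

end RescaledMCF

end

/-! ### The decomposition and its pointwise estimates -/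

set_option maxHeartbeats 1000000 in
open RescaledMCF in
theorem lemma3p3 {n : ℕ} (S : Set (Amb n)) (N : Amb n → Amb n)
    (hS : IsClosedHypersurface S) (hN : IsUnitNormal S N) (hshrink : IsShrinker S N) :
    (∀ u : Amb n → ℝ, ∀ p ∈ S, rmcfOp S N u p = secondVarOp S N u p + nonlinQ S N u p) ∧
    ∃ (C ε : ℝ), 0 < ε ∧
    -- `hbar u` depends only on `u`, and `Vbar v` depends only on `v`
    ∃ (hbar : (Amb n → ℝ) → Amb n → ℝ) (Vbar : (Amb n → ℝ) → Amb n → Amb n),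
    ∀ k : ℕ∞, 1 ≤ k → ∀ u v : Amb n → ℝ,
      ContDiffOn ℝ (k + 1) u S → ContDiffOn ℝ (k + 1) v S →
      c1Norm S N u ≤ ε → c1Norm S N v ≤ ε →
    ∃ (f h : Amb n → ℝ) (V W : Amb n → Amb n),
      ContDiffOn ℝ k f S ∧ ContDiffOn ℝ k h S ∧ ContDiffOn ℝ k (hbar u) S ∧
      IsTangentField k S N V ∧ IsTangentField k S N (Vbar v) ∧ IsTangentField k S N W ∧
      ∀ p ∈ S,
        -- `d = |u - v| + |∇u - ∇v|` and `D = |Hess_u - Hess_v|` at `p`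
        let d := |u p - v p| + ‖tanGrad S N u p - tanGrad S N v p‖
        let D := hsNorm (tanHess S N u p - tanHess S N v p)
        nonlinQ S N u p - nonlinQ S N v p =
            f p + tanDiv S N W p + inner ℝ (tanGrad S N (hbar u) p) (V p)
              + inner ℝ (tanGrad S N (fun x => h x + meanCurv S N x * (u x - v x)) p) (Vbar v p) ∧
        |f p| ≤ C * (c1Norm S N u + c1Norm S N v) * d ∧
        |h p| ≤ C * (c1Norm S N u + c1Norm S N v) * d ∧
        ‖W p‖ ≤ C * (c1Norm S N u + c1Norm S N v) * d ∧
        ‖V p‖ ≤ C * d ∧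
        |hbar u p| ≤ C * (c1Norm S N u + c1Norm S N v) ∧
        ‖Vbar v p‖ ≤ C * (c1Norm S N u + c1Norm S N v) ∧
        ‖tanGrad S N (hbar u) p‖ ≤ C * c1Norm S N u * (1 + hsNorm (tanHess S N u p)) ∧
        |tanDiv S N (Vbar v) p| ≤ C * c2Norm S N v ∧
        |tanDiv S N W p| ≤
          C * (c1Norm S N u + c1Norm S N v) * (d + D) + C * hsNorm (tanHess S N u p) * d ∧
        ‖tanGrad S N h p‖ ≤
          C * (1 + hsNorm (tanHess S N u p)) * d + C * (|v p| + ‖tanGrad S N v p‖) * D := by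
  refine ⟨fun u p _ => (add_sub_cancel _ _).symm, ?_⟩
  obtain ⟨CΦ, εΦ, hCΦ, hεΦ, hΦ⟩ := exists_jet_bounds hS hN (isSecondOrder_lowerOrder (opTrace n))
  obtain ⟨Cg, εg, hCg, hεg, hg, hg0⟩ := exists_jet_bounds_of_zero hS hN isSecondOrder_logSpeed
    (fun a => by simp [logSpeed])
  obtain ⟨CW, εW, hCW, hεW, hW, hW0⟩ := exists_jet_bounds_of_zero hS hN isSecondOrder_fluxErr
    (fun a => by simp [fluxErr])
  obtain ⟨M₀, hM₀⟩ :=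
    hS.isCompact.exists_bound_of_continuousOn (contDiffOn_shape hS hN).continuousOn
  obtain ⟨M₁, hM₁⟩ := hS.isCompact.exists_bound_of_continuousOn
    (contDiffOn_meanCurv hS hN).continuousOn
  obtain ⟨M₂, hM₂⟩ := hS.isCompact.exists_bound_of_continuousOn (contDiffOn_tanDeriv hS hN
    (m := ∞) (k := ∞) le_rfl le_rfl (contDiffOn_meanCurv hS hN)).continuousOn
  set M := |M₀| + |M₁| + |M₂| with hMdef
  have hM : 0 ≤ M := by positivity
  have hMA : ∀ p ∈ S, ‖tanDeriv S N N p‖ ≤ M := fun p hp => (hM₀ p hp).trans (by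
    linarith [le_abs_self M₀, abs_nonneg M₁, abs_nonneg M₂])
  have hMH : ∀ p ∈ S, |meanCurv S N p| ≤ M := fun p hp => (hM₁ p hp).trans (by
    linarith [le_abs_self M₁, abs_nonneg M₀, abs_nonneg M₂])
  have hMH' : ∀ p ∈ S, ‖tanDeriv S N (meanCurv S N) p‖ ≤ M := fun p hp => (hM₂ p hp).trans (by
    linarith [le_abs_self M₂, abs_nonneg M₀, abs_nonneg M₁])
  set t : ℝ := n + 1 with ht
  have ht0 : 0 ≤ t := by positivity
  -- A sum of nonnegative terms that dominates every coefficient below; t = n + 1 is the ambient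
  -- dimension, from |tr T| ≤ (n + 1)‖T‖.
  obtain ⟨C, hCdef⟩ : ∃ C, C = CΦ + M * (1 + CW) + 2 * Cg + (1 + 2 * CW) + t * (CW + 1 + M) :=
    ⟨_, rfl⟩
  have p1 : 0 ≤ M * (1 + CW) := by positivity
  have p2 : 0 ≤ t * CW := by positivity
  have p3 : 0 ≤ t * (1 + M) := by positivity
  have c1 : CΦ + M * (1 + CW) ≤ C := by linarith
  have c2 : 2 * Cg ≤ C := by linarith
  have c3 : 1 + 2 * CW ≤ C := by linarith
  have c4 : t * (CW + 1 + M) ≤ C := by linarith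
  have c5 : t * CW ≤ C := by linarith
  have c6 : Cg ≤ C := by linarith
  have c7 : CW ≤ C := by linarith
  have c8 : 1 + CW ≤ C := by linarith
  have hC0 : 0 ≤ C := hCg.trans c6
  -- The bound by 1 gives a² ≤ a, b² ≤ b and a + b ≤ 2, which turns quadratic bounds into linear
  -- ones.
  refine ⟨C, min (min εΦ 1) (min εg εW), by positivity, logSpeedAt S N, graphFlux S N, ?_⟩
  intro k hk u v hu hv hUε hVε
  have hk' : ((1 : ℕ∞) : ℕ∞ω) + 1 ≤ (k : ℕ∞ω) + 1 := by
    gcongr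
    exact_mod_cast hk
  have hu1 : ContDiffOn ℝ ((1 : ℕ∞) + 1) u S := hu.of_le hk'
  have hv1 : ContDiffOn ℝ ((1 : ℕ∞) + 1) v S := hv.of_le hk'
  simp only [le_min_iff] at hUε hVε
  have hur : ∀ p ∈ S, IsUnit (1 + u p • tanDeriv S N N p) := fun p hp =>
    (hg0 u hu1 p hp _ _ rfl rfl ((le_c1Norm hS hN hp hu1).trans hUε.2.1)).1
  have hvr : ∀ p ∈ S, IsUnit (1 + v p • tanDeriv S N N p) := fun p hp =>
    (hg0 v hv1 p hp _ _ rfl rfl ((le_c1Norm hS hN hp hv1).trans hVε.2.1)).1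
  -- Regularity of order k + 1 is needed here because f contains the gradient of H(u - v).
  have hHs : ContDiffOn ℝ (k + 1) (fun x => meanCurv S N x * (u x - v x)) S :=
    ((contDiffOn_meanCurv hS hN).of_le (WithTop.coe_le_coe.2 le_top)).mul (hu.sub hv)
  have hZu := contDiffOn_graphFlux hS hN hu hur
  have hZv := contDiffOn_graphFlux hS hN hv hvr
  have hfu : ContDiffOn ℝ k (fluxErrAt S N u) S :=
    contDiffOn_comp_jet hS hN contDiffOn_fluxErr hu hur
  have hfv : ContDiffOn ℝ k (fluxErrAt S N v) S :=
    contDiffOn_comp_jet hS hN contDiffOn_fluxErr hv hvr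
  have hgu : ContDiffOn ℝ k (logSpeedAt S N u) S :=
    contDiffOn_comp_jet hS hN contDiffOn_logSpeed hu hur
  have hgv : ContDiffOn ℝ k (logSpeedAt S N v) S :=
    contDiffOn_comp_jet hS hN contDiffOn_logSpeed hv hvr
  have hlu : ContDiffOn ℝ k (lowerOrderAt S N u) S :=
    contDiffOn_comp_jet hS hN (contDiffOn_lowerOrder (opTrace n)) hu hur
  have hlv : ContDiffOn ℝ k (lowerOrderAt S N v) S :=
    contDiffOn_comp_jet hS hN (contDiffOn_lowerOrder (opTrace n)) hv hvr
  have hZN : ∀ p ∈ S, ∀ w : Amb n → ℝ, (∀ p ∈ S, IsUnit (1 + w p • tanDeriv S N N p)) →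
      inner ℝ (graphFlux S N w p) (N p) = 0 := fun p hp w hw => by
    rw [real_inner_comm, inner_normal_graphFlux hS hN hp (hw p hp)]
  refine ⟨fun p => lowerOrderAt S N u p - lowerOrderAt S N v p -
      inner ℝ (tanGrad S N (fun x => meanCurv S N x * (u x - v x)) p) (graphFlux S N v p),
    fun p => logSpeedAt S N u p - logSpeedAt S N v p,
    fun p => graphFlux S N u p - graphFlux S N v p,
    fun p => fluxErrAt S N u p - fluxErrAt S N v p,
    (hlu.sub hlv).sub ((contDiffOn_tanGrad hS hN le_rfl
      (WithTop.coe_le_coe.2 le_top) hHs).inner ℝ hZv), hgu.sub hgv, hgu,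
    ⟨hZu.sub hZv, fun p hp => ?_⟩, ⟨hZv, fun p hp => hZN p hp v hvr⟩,
    ⟨hfu.sub hfv, fun p hp => ?_⟩, ?_⟩
  · rw [inner_sub_left, hZN p hp u hur, hZN p hp v hvr, sub_zero]
  · have hN' : ∀ w : Amb n → ℝ, (∀ p ∈ S, IsUnit (1 + w p • tanDeriv S N N p)) →
        inner ℝ (fluxErrAt S N w p) (N p) = 0 := fun w hw => by
      have h1 := hZN p hp w hw
      rw [graphFlux_eq, inner_add_left, real_inner_comm (N p) (tanGrad S N w p),
        hN.inner_tanGrad_normal hp, add_zero] at h1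
      exact h1
    rw [inner_sub_left, hN' u hur, hN' v hvr, sub_zero]
  intro p hp d D
  obtain ⟨a, ha⟩ : ∃ a, a = |u p| + ‖tanGrad S N u p‖ := ⟨_, rfl⟩
  obtain ⟨b, hb⟩ : ∃ b, b = |v p| + ‖tanGrad S N v p‖ := ⟨_, rfl⟩
  obtain ⟨K, hK⟩ : ∃ K, K = hsNorm (tanHess S N u p) := ⟨_, rfl⟩
  obtain ⟨L, hL⟩ : ∃ L, L = hsNorm (tanHess S N v p) := ⟨_, rfl⟩
  obtain ⟨A, hA⟩ : ∃ A, A = c1Norm S N u := ⟨_, rfl⟩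
  obtain ⟨B, hB⟩ : ∃ B, B = c1Norm S N v := ⟨_, rfl⟩
  have haA : a ≤ A := by rw [ha, hA]; exact le_c1Norm hS hN hp hu1
  have hbB : b ≤ B := by rw [hb, hB]; exact le_c1Norm hS hN hp hv1
  have hbL : b + L ≤ c2Norm S N v := by rw [hb, hL]; exact le_c2Norm hS hN hp hv1
  rw [← hA] at hUε ⊢
  rw [← hB] at hVε ⊢
  have ha0 : 0 ≤ a := by rw [ha]; positivity
  have hb0 : 0 ≤ b := by rw [hb]; positivity
  have hd0 : 0 ≤ d := by positivity
  have hD0 : 0 ≤ D := hsNorm_nonneg _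
  have hK0 : 0 ≤ K := hK ▸ hsNorm_nonneg _
  have hL0 : 0 ≤ L := hL ▸ hsNorm_nonneg _
  have hA0 := ha0.trans haA
  have hB0 := hb0.trans hbB
  have ha1 : a ≤ 1 := haA.trans hUε.1.2
  have hb1 : b ≤ 1 := hbB.trans hVε.1.2
  have hbb : b * b ≤ b := mul_le_of_le_one_right hb0 hb1
  have haa : a * a ≤ a := mul_le_of_le_one_right ha0 ha1
  have hab : a + b ≤ A + B := add_le_add haA hbB
  obtain ⟨-, hΦ1, -⟩ := hΦ u v hu1 hv1 p hp a b d D K ha hb rfl rfl hK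
    (haA.trans hUε.1.1) (hbB.trans hVε.1.1)
  obtain ⟨hg1, hg2⟩ := hg u v hu1 hv1 p hp a b d D K ha hb rfl rfl hK
    (haA.trans hUε.2.1) (hbB.trans hVε.2.1)
  obtain ⟨hW1, hW2⟩ := hW u v hu1 hv1 p hp a b d D K ha hb rfl rfl hK
    (haA.trans hUε.2.2) (hbB.trans hVε.2.2)
  obtain ⟨-, hg3, hg4⟩ := hg0 u hu1 p hp a K ha hK (haA.trans hUε.2.1)
  obtain ⟨-, hW3, hW4⟩ := hW0 v hv1 p hp b L hb hL (hbB.trans hVε.2.2)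
  have hvb : ‖tanGrad S N v p‖ ≤ b := by rw [hb]; exact le_add_of_nonneg_left (abs_nonneg _)
  have hfluxv : ‖graphFlux S N v p‖ ≤ (1 + CW) * b := by
    rw [graphFlux_eq]
    refine (norm_add_le _ _).trans ((add_le_add hW3 hvb).trans ?_)
    calc _ = CW * (b * b) + b := by ring
      _ ≤ CW * b + b := by gcongr
      _ = _ := by ring
  have hud : DifferentiableWithinAt ℝ u S p := hu1.differentiableOn (by simp) p hp
  have hvd : DifferentiableWithinAt ℝ v S p := hv1.differentiableOn (by simp) p hp
  have hsub : ∀ {G : Type} [NormedAddCommGroup G] [NormedSpace ℝ G] {X X₁ : Amb n → G},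
      ContDiffOn ℝ k X S → ContDiffOn ℝ k X₁ S →
      tanDeriv S N (fun x => X x - X₁ x) p = tanDeriv S N X p - tanDeriv S N X₁ p := by
    intro G _ _ X X₁ hX hX₁
    have hk0 : ((k : ℕ∞) : ℕ∞ω) ≠ 0 := by
      have : k ≠ 0 := (zero_lt_one.trans_le hk).ne'
      exact_mod_cast this
    exact tanDeriv_sub hS hN hp (hX.differentiableOn hk0 p hp) (hX₁.differentiableOn hk0 p hp)
  rw [← hb, ← hK]
  refine ⟨nonlinQ_sub hS hN hu1 hv1 hur hvr hp, ?_, ?_, ?_, ?_, ?_, ?_, ?_, ?_, ?_, ?_⟩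
  -- The compensating term is quadratic: the gradient of H(u - v) is at most M d, and Z_v is at most
  -- a multiple of b.
  · have e1 : |inner ℝ (tanGrad S N (fun x => meanCurv S N x * (u x - v x)) p)
        (graphFlux S N v p)| ≤ (M * d) * ((1 + CW) * b) :=
      (abs_real_inner_le_norm _ _).trans (mul_le_mul
        (norm_tanGrad_meanCurv_mul_sub_le hS hN hp hud hvd (hMH p hp) (hMH' p hp)) hfluxv
        (norm_nonneg _) (by positivity))
    refine (abs_sub _ _).trans ((add_le_add hΦ1 e1).trans ?_)
    calc _ = (CΦ * (a + b) + M * (1 + CW) * b) * d := by ring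
      _ ≤ (CΦ * (A + B) + M * (1 + CW) * (A + B)) * d := by gcongr; linarith
      _ = (CΦ + M * (1 + CW)) * (A + B) * d := by ring
      _ ≤ _ := by gcongr
  · exact hg1.trans (by gcongr)
  · exact hW1.trans (by gcongr)
  -- The linear part ∇u - ∇v dominates, so no small factor can be gained in the bound on V.
  · have e1 : graphFlux S N u p - graphFlux S N v p =
        (fluxErrAt S N u p - fluxErrAt S N v p) + (tanGrad S N u p - tanGrad S N v p) := by
      rw [graphFlux_eq, graphFlux_eq]; abel
    have e2 : ‖tanGrad S N u p - tanGrad S N v p‖ ≤ d := le_add_of_nonneg_left (abs_nonneg _)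
    show ‖graphFlux S N u p - graphFlux S N v p‖ ≤ C * d
    rw [e1]
    refine (norm_add_le _ _).trans ((add_le_add hW1 e2).trans ?_)
    calc _ ≤ CW * (1 + 1) * d + d := by gcongr
      _ = (1 + 2 * CW) * d := by ring
      _ ≤ _ := by gcongr
  · refine hg3.trans ?_
    calc _ = Cg * (a * a) := by ring
      _ ≤ C * (A + B) := by gcongr; linarith
  · refine hfluxv.trans ?_
    gcongr
    linarith
  · rw [norm_tanGrad]
    refine hg4.trans ?_
    calc _ = Cg * (a * a + K * a) := by ring
      _ ≤ Cg * (a + K * a) := by gcongr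
      _ = Cg * a * (1 + K) := by ring
      _ ≤ _ := by gcongr
  · have e1 : tanDeriv S N (graphFlux S N v) p =
        tanDeriv S N (fluxErrAt S N v) p + tanDeriv S N (tanGrad S N v) p := by
      have hfv1 : DifferentiableWithinAt ℝ (fluxErrAt S N v) S p :=
        (contDiffOn_comp_jet hS hN contDiffOn_fluxErr hv1 hvr).differentiableOn (by simp) p hp
      exact (tanDeriv_congr hp fun x _ => graphFlux_eq).trans
        (tanDeriv_add hS hN hp hfv1 (differentiableWithinAt_tanGrad hS hN hp hv1))
    have e2 := norm_tanDeriv_tanGrad_le hS hN hp hv1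
    rw [← hL] at e2
    rw [tanDiv, ← opTrace_apply, e1]
    refine (abs_opTrace_le _).trans ?_
    -- Only ∇v contributes the Hessian of v with a coefficient that is not small; the flux error
    -- contributes it multiplied by b ≤ 1.
    have e3 : ‖tanDeriv S N (fluxErrAt S N v) p + tanDeriv S N (tanGrad S N v) p‖ ≤
        (CW + 1 + M) * (b + L) := by
      refine (norm_add_le _ _).trans ((add_le_add hW4 e2).trans ?_)
      calc _ ≤ CW * (b * b) + CW * (L * b) + (L + M * b) := by
            rw [mul_assoc, mul_assoc]
            gcongr
            exact hMA p hp
        _ ≤ CW * b + CW * (L * 1) + (L + M * b) := by gcongr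
        _ ≤ _ := by linarith [mul_nonneg hM hL0]
    calc _ ≤ t * ((CW + 1 + M) * (b + L)) := by gcongr
      _ = t * (CW + 1 + M) * (b + L) := by ring
      _ ≤ _ := by gcongr
  · rw [tanDiv, ← opTrace_apply, hsub hfu hfv]
    refine (abs_opTrace_le _).trans ?_
    calc _ ≤ t * (CW * (a + b) * d + CW * K * d + CW * b * D) := by gcongr; exact hW2
      _ ≤ t * (CW * (A + B) * d + CW * K * d + CW * (A + B) * D) := by gcongr; linarith
      _ = t * CW * (A + B) * (d + D) + t * CW * K * d := by ring
      _ ≤ _ := by gcongr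
  · rw [norm_tanGrad, hsub hgu hgv]
    refine hg2.trans ?_
    -- Here a + b ≤ 2 suffices for the first term, while the pointwise b is kept in front of D, as
    -- the statement demands.
    calc _ ≤ Cg * (1 + 1) * d + 2 * Cg * K * d + Cg * b * D := by
          gcongr
          linarith
      _ = 2 * Cg * (1 + K) * d + Cg * b * D := by ring
      _ ≤ _ := by gcongr
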